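/- **Setting.** A base station with $M$ antennas serves $K=TK_B$ homogeneous single-antenna users, with $T$ and $K_B\ge 1$ fixed, in one round-robin period of $T$ resource blocks, $K_B$ users per block. The channel vectors $\mathbf g_1,\dots,\mathbf g_K\in\mathbb C^{1\times M}$ are independent with law $\mathcal{CN}(\mathbf 0,\beta\mathbf I_M)$, where $\beta>0$. The station knows the reported channels $\mathbf f_k$; under accurate reporting $\mathbf f_k=\mathbf g_k$. If $K_M$ users underreport with ratio $\delta\in(0,1)$, then $\mathbf f_k=\sqrt\delta\,\mathbf g_k$ for $k\le K_M$ and $\mathbf f_k=\mathbf g_k$ for the other (honest) users. For the group $S$ of users served in one block, with reported channel matrix $\mathbf F$ and true channel matrix $\mathbf G$ (the matrices with rows $\mathbf f_k$ and $\mathbf g_k$, $k\in S$), the station transmits $\mathbf x=\mathbf W\mathbf D\mathbf P\mathbf s$, where $\mathbf s$ has uncorrelated entries of zero mean and unit variance, $\mathbf W=\mathbf F^H(\mathbf F\mathbf F^H)^{-1}$ has columns $\mathbf w_k$, $\mathbf D=\mathrm{diag}(d_k)$ with $d_k=1/\|\mathbf w_k\|$, and $\mathbf P=\mathrm{diag}(\sqrt{P_k})$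 is the max-min power control: $\sum_{k\in S} P_k=P$ and $P_kd_k^2$ is the same for all $k\in S$. User $k$ receives the $k$-th entry of $\mathbf G\mathbf x$ plus noise of variance $\sigma_n^2$; here $P,\sigma_n^2>0$ are fixed. Its rate is $\log_2(1+\mathrm{SNR}_k)$, where $\mathrm{SNR}_k=|(\mathbf G\mathbf W\mathbf D\mathbf P)_{kk}|^2/\sigma_n^2$ (there is no interference). In *channel magnitude based grouping*, each group in turn consists of the $K_B$ remaining users with the largest reported magnitudes $\|\mathbf f_k\|^2$; in *random grouping*, each group in turn is a uniformly random set of $K_B$ of the remaining users, independent of the channels. For $1\le t\le T$ let $R_t^{a,CM}$ and $R_t^{a,rand}$ be the expected rates per user in the $t$-th block under accurate reporting with channel magnitude based and with random grouping, respectively, let $R_t^{m,CM}$ be the expected rate per honest user in the $t$-th block under channel magnitude based grouping when $K_M$ users underreport, and let $R^{a,rand}=\frac1K\sum_{t=1}^T K_BR_t^{a,rand}$. (All of these depend on $M$.) **Proposition.** The expectations that define $R_t^{a,CM}$ and $R_t^{a,rand}$ ($1\le t\le T$), and those that define $R_t^{m,CM}$ ($1\le t\le T-1$, $K_M<K_B$),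 are finite for every $M\ge K_B$, and: 1. $R_t^{a,CM}-R_t^{a,rand}\to 0$ as $M\to\infty$ for $1\le t\le T$. Moreover $R^{a,rand}=R_t^{a,rand}$ for all $1\le t\le T$ and all $M\ge K_B$. 2. If $K_M<K_B$ users underreport with a fixed ratio $\delta\in(0,1)$, then $R_t^{m,CM}-R_t^{a,CM}\to 0$ as $M\to\infty$ for $1\le t\le T-1$. -/

import Mathlib

open MeasureTheory ProbabilityTheory Filter Topology
open scoped BigOperators Matrix

namespace MassiveMIMO

noncomputable section

/-! ### The channel -/

/-- The circularly symmetric complex Gaussian law `CN(0, β)`: the real and imaginary parts are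
independent real Gaussians with mean `0` and variance `β / 2`. -/
def complexGaussian (β : ℝ) : Measure ℂ :=
  ((gaussianReal 0 (β / 2).toNNReal).prod (gaussianReal 0 (β / 2).toNNReal)).map
    (fun p => (⟨p.1, p.2⟩ : ℂ))

/-- Channel matrices of `K` users and `M` antennas: row `k` is the channel vector of user `k`. (Kept as
a function type, which carries the product measurable structure.) -/
abbrev Channel (K M : ℕ) : Type := Fin K → Fin M → ℂ

/-- The law of the channel matrix `G` of `K` homogeneous users and `M` antennas (i.i.d. Rayleigh
fading): the rows are independent, each with law `CN(0, β I_M)`. -/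
def channelLaw (K M : ℕ) (β : ℝ) : Measure (Channel K M) :=
  Measure.pi fun _ : Fin K => Measure.pi fun _ : Fin M => complexGaussian β

/-- The channel magnitude of user `k`: the squared Euclidean norm of its channel vector. -/
def channelMagnitude {K M : ℕ} (G : Channel K M) (k : Fin K) : ℝ :=
  ∑ m, ‖G k m‖ ^ 2

/-- The reported channel matrix `F = Δ^{1/2} G`, where the diagonal matrix `Δ` has its first `KM`
diagonal entries (those of the misreporting users) equal to `δ` and the other ones equal to `1`. -/
def reportedChannel {K M : ℕ} (KM : ℕ) (δ : ℝ) (G : Channel K M) :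
    Channel K M :=
  fun k m => ((if (k : ℕ) < KM then √δ else 1 : ℝ) : ℂ) * G k m

/-! ### Zero-forcing transmission to one group of users

`ι` is the set of the users served in one resource block, `F` their reported channels (known to the
base station) and `G` their true channels. -/

section Transmission

variable {ι : Type*} [Fintype ι] [DecidableEq ι] {M : ℕ}

/-- The pseudoinverse `W = Fᴴ (F Fᴴ)⁻¹`. -/
def zfMatrix (F : Matrix ι (Fin M) ℂ) : Matrix (Fin M) ι ℂ :=
  Fᴴ * (F * Fᴴ)⁻¹

/-- The effective channel gain `d_k = 1 / ‖w_k‖`, where `w_k` is the `k`-th column of `W`. -/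
def effectiveGain (F : Matrix ι (Fin M) ℂ) (k : ι) : ℝ :=
  1 / √(∑ m, ‖zfMatrix F m k‖ ^ 2)

/-- The max-min power control: the powers `P_k` with total `P` for which `P_k d_k ^ 2` is the same
for all the users `k` of the group. -/
def userPower (P : ℝ) (F : Matrix ι (Fin M) ℂ) (k : ι) : ℝ :=
  P / (∑ j, 1 / effectiveGain F j ^ 2) / effectiveGain F k ^ 2

/-- The matrix `G W D P` that maps the source data vector `s` to the noiseless received signals. Here
`W`, `D`, `P` are computed from the reported channels `F`, and the signals go through the true
channels `G`. -/
def receivedMatrix (P : ℝ) (F G : Matrix ι (Fin M) ℂ) : Matrix ι ι ℂ :=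
  G * zfMatrix F * Matrix.diagonal (fun k => (effectiveGain F k : ℂ)) *
    Matrix.diagonal (fun k => (√(userPower P F k) : ℂ))

/-- The signal-to-noise ratio that user `k` really receives, with noise variance `σ ^ 2`. (Since the
rows of `F` are multiples of those of `G`, the off-diagonal entries of `receivedMatrix` vanish, so
that there is no interference.) -/
def receivedSNR (P σ : ℝ) (F G : Matrix ι (Fin M) ℂ) (k : ι) : ℝ :=
  ‖receivedMatrix P F G k k‖ ^ 2 / σ ^ 2

end Transmission

/-- The channel matrix of the users in the group `S`. -/
def groupRows {K M : ℕ} (G : Channel K M) (S : Finset (Fin K)) : Matrix S (Fin M) ℂ :=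
  Matrix.of fun k m => G k m

/-- The rate per user, averaged over the users `k` with `honest k` in the group `S`, when `G` is the
true and `F` the reported channel matrix. -/
def groupRate {K M : ℕ} (P σ : ℝ) (F G : Channel K M) (honest : Fin K → Prop)
    [DecidablePred honest] (S : Finset (Fin K)) : ℝ :=
  Finset.expect (Finset.univ.filter fun k : S => honest k) fun k =>
    Real.logb 2 (1 + receivedSNR P σ (groupRows F S) (groupRows G S) k)

/-! ### User grouping

The resource blocks of a scheduling period are numbered `0, …, T - 1`. -/

/-- The `n` users with the largest values of `X` among the candidates `C` (all of `C` if it has fewer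
than `n` elements); ties, which have probability zero, are broken by the index. -/
def largest {K : ℕ} (n : ℕ) (X : Fin K → ℝ) (C : Finset (Fin K)) : Finset (Fin K) :=
  C.filter fun k => (C.filter fun j => X k < X j ∨ (X j = X k ∧ j < k)).card < n

/-- The users that are left after the first `t` groups have been formed, each from the `KB` residual
users with the largest magnitudes. -/
def residualUsers {K : ℕ} (KB : ℕ) (X : Fin K → ℝ) : ℕ → Finset (Fin K)
  | 0 => Finset.univ
  | t + 1 => residualUsers KB X t \ largest KB X (residualUsers KB X t)

/-- The group served in resource block `t` under channel magnitude based user grouping, where `X` are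
the magnitudes known to the base station. -/
def magnitudeGroup {K : ℕ} (KB : ℕ) (X : Fin K → ℝ) (t : ℕ) : Finset (Fin K) :=
  largest KB X (residualUsers KB X t)

/-- The expected value of `f` at the group of resource block `t` under random user grouping of the
candidates `C`: every group is drawn uniformly from the sets of `KB` users among those that are still
left. -/
def randomGroupExpect {K : ℕ} (KB : ℕ) (f : Finset (Fin K) → ℝ) : ℕ → Finset (Fin K) → ℝ
  | 0, C => 𝔼 S ∈ C.powersetCard KB, f S
  | t + 1, C => 𝔼 S ∈ C.powersetCard KB, randomGroupExpect KB f t (C \ S)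

/-! ### Rates in resource block `t`, for a given channel matrix `G` -/

/-- Accurate reporting, channel magnitude based user grouping. -/
def accurateMagnitudeRate {K M : ℕ} (KB : ℕ) (P σ : ℝ) (t : ℕ) (G : Channel K M) : ℝ :=
  groupRate P σ G G (fun _ => True) (magnitudeGroup KB (channelMagnitude G) t)

/-- Accurate reporting, random user grouping (averaged over the random grouping, which is independent
of the channels). -/
def accurateRandomRate {K M : ℕ} (KB : ℕ) (P σ : ℝ) (t : ℕ) (G : Channel K M) : ℝ :=
  randomGroupExpect KB (groupRate P σ G G (fun _ => True)) t Finset.univ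

/-- Honest users, when the first `KM` users misreport with scaling ratio `δ`, channel magnitude based
user grouping. The grouping, the precoding and the power control use the reported channels. -/
def misreportedMagnitudeRate {K M : ℕ} (KB KM : ℕ) (δ P σ : ℝ) (t : ℕ)
    (G : Channel K M) : ℝ :=
  groupRate P σ (reportedChannel KM δ G) G (fun k => ¬ (k : ℕ) < KM)
    (magnitudeGroup KB (channelMagnitude (reportedChannel KM δ G)) t)

/-! ### Ergodic rates -/

/-- `R_t^{a,CM}`. -/
def RaCM (K KB M : ℕ) (β P σ : ℝ) (t : ℕ) : ℝ :=
  ∫ G : Channel K M, accurateMagnitudeRate KB P σ t G ∂channelLaw K M β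

/-- `R_t^{a,rand}`. -/
def RaRand (K KB M : ℕ) (β P σ : ℝ) (t : ℕ) : ℝ :=
  ∫ G : Channel K M, accurateRandomRate KB P σ t G ∂channelLaw K M β

/-- `R^{a,rand}`, the per user rate across one scheduling period of `T` resource blocks. -/
def RaRandPeriod (T K KB M : ℕ) (β P σ : ℝ) : ℝ :=
  1 / (K : ℝ) * ∑ t ∈ Finset.range T, (KB : ℝ) * RaRand K KB M β P σ t

/-- `R_t^{m,CM}`. -/
def RmCM (K KB KM M : ℕ) (δ β P σ : ℝ) (t : ℕ) : ℝ :=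
  ∫ G : Channel K M, misreportedMagnitudeRate KB KM δ P σ t G ∂channelLaw K M β

end

end MassiveMIMO

open MassiveMIMO

/-!
All the rates in question, minus the same deterministic quantity, tend to `0`.

*Rates.* If `F Fᴴ` is invertible, then zero forcing gives `F W = 1`, and max-min power control gives
every honest user of a group the signal-to-noise ratio `P / (σ² ∑ ‖w_k‖²)`, where `∑ ‖w_k‖²` is the
trace of `(F Fᴴ)⁻¹` (`receivedSNR_eq`, `zfPower_eq_trace`). Hence the rate of a group depends on its
reported channel matrix only (`zfRate`). If `F Fᴴ` is singular, then `W` and the rate are `0` by the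
convention for inverses, so that no almost sure invertibility is needed.

*Hardening.* Let `V` be the squared distance of the normalized Gram matrix `G Gᴴ / (β M)` of all `K`
users from the identity. Let `c_M = log₂ (1 + P β M / (KB σ²))` be the rate of a group with orthogonal
channels (`hardenedRate`). If `V` is small, then the rates of all groups of `KB` users are close to
`c_M`, uniformly in `M`, because the matrix inverse is continuous at the identity. For all channels,
rates are nonnegative, and by Cauchy-Schwarz they exceed `c_M` by at most a multiple of `2 + V`. So for
each `η > 0` there is a `C` with `|rate - c_M| ≤ η + C (1 + c_M) V` for all channels and all groups of
`KB` users (`exists_forall_abs_zfRate_sub_le`). The columns of the channel matrix are i.i.d. with finite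
fourth moments, so the expectation of `V` is `O(1 / M)` (`integrable_gramError`), while `c_M` grows like
`log M`. Therefore the expected rates differ from `c_M` by `o(1)`, even if the group depends on the
channels (`tendsto_integral_sub_hardenedRate`).

*Random grouping.* The users are exchangeable, so every group of `KB` users has the same expected rate
(`integral_zfRate_eq`), and this rate is `RaRand`, whatever the block.

*Underreporting.* If `V` is small, then the misreporting users have the smallest reported magnitudes.
There are fewer than `KB` of them, so they are not served as long as two groups are left
(`magnitudeGroup_not_lt`). If `V` is not small, then the underreporting of other users changes the rate
of an honest one by at most `log₂ (1 / δ)` (`zfRate_reportedChannel`). This contributes another multiple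
of `V` to the bound above.
-/

namespace MassiveMIMO

/-! ### User grouping -/

theorem largest_subset {K : ℕ} (n : ℕ) (X : Fin K → ℝ) (C : Finset (Fin K)) :
    largest n X C ⊆ C :=
  Finset.filter_subset _ _

/-- The ranks of the candidates, counted from the top, are `0, …, #C - 1`, each taken once; the
tie-breaking makes the comparison a strict linear order. -/
theorem card_largest {K : ℕ} (n : ℕ) (X : Fin K → ℝ) (C : Finset (Fin K)) (h : n ≤ C.card) :
    (largest n X C).card = n := by
  classical
  set r : Fin K → ℕ := fun k => (C.filter fun j => X k < X j ∨ (X j = X k ∧ j < k)).card with hr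
  have hlt : ∀ k ∈ C, ∀ l ∈ C, (X l < X k ∨ (X k = X l ∧ k < l)) → r k < r l := by
    intro k hk l hl hkl
    refine Finset.card_lt_card ⟨fun j hj => ?_, fun hsub => ?_⟩
    · simp only [Finset.mem_filter] at hj ⊢
      grind
    · have : k ∈ C.filter fun j => X k < X j ∨ (X j = X k ∧ j < k) :=
        hsub (by simp only [Finset.mem_filter]; exact ⟨hk, hkl⟩)
      simp at this
  have hinj : Set.InjOn r C := by
    intro k hk l hl hkl
    by_contra hne
    have h1 := hlt k hk l hl
    have h2 := hlt l hl k hk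
    grind
  have himg : C.image r = Finset.range C.card := by
    refine Finset.eq_of_subset_of_card_le (fun i hi => ?_) ?_
    · obtain ⟨k, hk, rfl⟩ := Finset.mem_image.1 hi
      refine Finset.mem_range.2 (Finset.card_lt_card ?_)
      refine Finset.filter_ssubset.2 ⟨k, hk, by simp⟩
    · rw [Finset.card_range, Finset.card_image_of_injOn hinj]
  have hsub : Set.InjOn r (largest n X C) := hinj.mono (by exact_mod_cast largest_subset n X C)
  rw [← Finset.card_image_of_injOn hsub]
  have : (largest n X C).image r = (C.image r).filter (· < n) := by
    rw [Finset.filter_image]; rfl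
  rw [this, himg]
  have : (Finset.range C.card).filter (· < n) = Finset.range n := by
    ext i; simp; omega
  rw [this, Finset.card_range]

theorem card_residualUsers {K : ℕ} (KB : ℕ) (X : Fin K → ℝ) (t : ℕ) (h : t * KB ≤ K) :
    (residualUsers KB X t).card = K - t * KB := by
  induction t with
  | zero => simp [residualUsers]
  | succ t ih =>
    have h' : t * KB + KB ≤ K := by rwa [Nat.succ_mul] at h
    have ih := ih (by omega)
    rw [residualUsers, Finset.card_sdiff_of_subset (largest_subset _ _ _),
      card_largest _ _ _ (by omega), ih, Nat.succ_mul]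
    omega

theorem card_magnitudeGroup {K : ℕ} (KB : ℕ) (X : Fin K → ℝ) (t : ℕ) (h : (t + 1) * KB ≤ K) :
    (magnitudeGroup KB X t).card = KB := by
  have h' : t * KB + KB ≤ K := by rwa [Nat.succ_mul] at h
  refine card_largest _ _ _ ?_
  rw [card_residualUsers KB X t (by omega)]
  omega

/-- If `KM < KB` users have smaller magnitudes than all the others, then they are not served as long
as at least two groups are left: there are always `KB` better candidates. -/
theorem magnitudeGroup_not_lt {K : ℕ} {KB KM : ℕ} (X : Fin K → ℝ) (t : ℕ)
    (h : (t + 2) * KB ≤ K) (hKM : KM < KB)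
    (hX : ∀ k j : Fin K, (k : ℕ) < KM → ¬ (j : ℕ) < KM → X k < X j)
    {k : Fin K} (hk : k ∈ magnitudeGroup KB X t) : ¬ (k : ℕ) < KM := by
  classical
  intro hlt
  have h' : t * KB + 2 * KB ≤ K := by rwa [add_mul] at h
  set C := residualUsers KB X t
  have hC : C.card = K - t * KB := card_residualUsers KB X t (by omega)
  have hrank := (Finset.mem_filter.1 (show k ∈ largest KB X C from hk)).2
  have hsub : C \ (Finset.univ.filter fun j : Fin K => (j : ℕ) < KM) ⊆
      C.filter fun j => X k < X j ∨ (X j = X k ∧ j < k) := by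
    intro j hj
    simp only [Finset.mem_sdiff, Finset.mem_filter, Finset.mem_univ, true_and] at hj ⊢
    exact ⟨hj.1, Or.inl (hX k j hlt hj.2)⟩
  have h1 := Finset.card_le_card hsub
  have h2 := Finset.le_card_sdiff (Finset.univ.filter fun j : Fin K => (j : ℕ) < KM) C
  have h3 : (Finset.univ.filter fun j : Fin K => (j : ℕ) < KM).card ≤ KM := by
    have := Finset.card_le_card_of_injOn (s := Finset.univ.filter fun j : Fin K => (j : ℕ) < KM)
      (t := Finset.range KM) (fun j => (j : ℕ)) (by intro j; simp) (by
        intro a _ b _ hab; exact Fin.ext hab)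
    simpa using this
  omega

/-- The group depends on the magnitudes only through the order of the users, of which there are
finitely many. -/
theorem measurable_magnitudeGroup {K : ℕ} (KB : ℕ) (t : ℕ) :
    Measurable[_, ⊤] (fun X : Fin K → ℝ => magnitudeGroup KB X t) := by
  classical
  let ord : (Fin K → ℝ) → Fin K → Fin K → Bool :=
    fun X k j => decide (X k < X j ∨ (X j = X k ∧ j < k))
  have hord : Measurable ord := by
    refine measurable_pi_iff.2 fun k => measurable_pi_iff.2 fun j => ?_
    refine measurable_to_bool ?_
    have : (fun X => ord X k j) ⁻¹' {true} = {X | X k < X j ∨ (X j = X k ∧ j < k)} := by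
      ext X; simp [ord]
    rw [this]
    refine MeasurableSet.union (measurableSet_lt (measurable_pi_apply k) (measurable_pi_apply j)) ?_
    exact (measurableSet_eq_fun (measurable_pi_apply j) (measurable_pi_apply k)).inter
      (MeasurableSet.const _)
  have hlargest : ∀ X Y, ord X = ord Y → ∀ C, largest KB X C = largest KB Y C := by
    intro X Y h C
    have : ∀ k j, (X k < X j ∨ (X j = X k ∧ j < k)) ↔ (Y k < Y j ∨ (Y j = Y k ∧ j < k)) := by
      intro k j
      have := congrFun (congrFun h k) j
      exact decide_eq_decide.1 this
    simp only [largest, this]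
  have hres : ∀ X Y, ord X = ord Y → ∀ t, residualUsers KB X t = residualUsers KB Y t := by
    intro X Y h t
    induction t with
    | zero => rfl
    | succ t ih => simp only [residualUsers, ih, hlargest X Y h]
  intro A _
  have : (fun X : Fin K → ℝ => magnitudeGroup KB X t) ⁻¹' A =
      ord ⁻¹' (ord '' ((fun X : Fin K → ℝ => magnitudeGroup KB X t) ⁻¹' A)) := by
    refine Set.Subset.antisymm (Set.subset_preimage_image _ _) ?_
    rintro X ⟨Y, hY, hXY⟩
    have : magnitudeGroup KB X t = magnitudeGroup KB Y t := by
      rw [magnitudeGroup, magnitudeGroup, hres Y X hXY, hlargest Y X hXY]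
    simpa [this] using hY
  rw [this]
  exact hord (Set.toFinite _).measurableSet

theorem randomGroupExpect_const {K : ℕ} (KB : ℕ) {f : Finset (Fin K) → ℝ} {c : ℝ}
    (hf : ∀ S, S.card = KB → f S = c) (t : ℕ) :
    ∀ C : Finset (Fin K), (t + 1) * KB ≤ C.card → randomGroupExpect KB f t C = c := by
  induction t with
  | zero =>
    intro C hC
    have hne : (C.powersetCard KB).Nonempty := Finset.powersetCard_nonempty.2 (by omega)
    rw [randomGroupExpect, Finset.expect_congr rfl (g := fun _ => c)
      fun S hS => hf S (Finset.mem_powersetCard.1 hS).2, Finset.expect_const hne]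
  | succ t ih =>
    intro C hC
    have hC' : (t + 1) * KB + KB ≤ C.card := by rwa [Nat.succ_mul (t + 1)] at hC
    have hne : (C.powersetCard KB).Nonempty := Finset.powersetCard_nonempty.2 (by omega)
    rw [randomGroupExpect, Finset.expect_congr rfl (g := fun _ => c) fun S hS => ?_,
      Finset.expect_const hne]
    obtain ⟨h1, h2⟩ := Finset.mem_powersetCard.1 hS
    refine ih _ ?_
    rw [Finset.card_sdiff_of_subset h1]
    omega

theorem integrable_expect {α Ω : Type*} [MeasurableSpace Ω] {μ : Measure Ω} (s : Finset α)
    {f : Ω → α → ℝ} (hf : ∀ a ∈ s, Integrable (fun ω => f ω a) μ) :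
    Integrable (fun ω => 𝔼 a ∈ s, f ω a) μ ∧
      ∫ ω, 𝔼 a ∈ s, f ω a ∂μ = 𝔼 a ∈ s, ∫ ω, f ω a ∂μ := by
  simp only [Finset.expect_eq_sum_div_card]
  refine ⟨(integrable_finsetSum _ hf).div_const _, ?_⟩
  rw [integral_div, integral_finsetSum _ hf]

/-- Averaging over the random grouping commutes with averaging over the channels. -/
theorem integrable_randomGroupExpect {Ω : Type*} [MeasurableSpace Ω] {μ : Measure Ω} {K : ℕ}
    (KB : ℕ) {f : Ω → Finset (Fin K) → ℝ} (hf : ∀ S, Integrable (fun ω => f ω S) μ) (t : ℕ) :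
    ∀ C : Finset (Fin K), Integrable (fun ω => randomGroupExpect KB (f ω) t C) μ ∧
      ∫ ω, randomGroupExpect KB (f ω) t C ∂μ =
        randomGroupExpect KB (fun S => ∫ ω, f ω S ∂μ) t C := by
  induction t with
  | zero => exact fun C => integrable_expect _ fun S _ => hf S
  | succ t ih =>
    intro C
    have h := integrable_expect (μ := μ) (C.powersetCard KB)
      (f := fun ω S => randomGroupExpect KB (f ω) t (C \ S)) fun S _ => (ih _).1
    refine ⟨h.1, ?_⟩
    simp only [randomGroupExpect]
    rw [h.2]
    exact Finset.expect_congr rfl fun S _ => (ih _).2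

/-! ### Product measures -/

section PiMeasure

variable {ι κ Ω : Type*} [Fintype ι] [Fintype κ] [MeasurableSpace Ω]

theorem measurePreserving_comp_equiv (μ : Measure Ω) [IsProbabilityMeasure μ] (e : κ ≃ ι) :
    MeasurePreserving (fun (x : ι → Ω) k => x (e k)) (Measure.pi fun _ => μ)
      (Measure.pi fun _ => μ) := by
  convert measurePreserving_piCongrLeft (fun _ : κ => μ) e.symm using 1
  ext x k
  simpa using (MeasurableEquiv.piCongrLeft_apply_apply (β := fun _ => Ω) (x := x) (i := e k)
    e.symm).symm

theorem measurePreserving_curry (μ : Measure Ω) [IsProbabilityMeasure μ] :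
    MeasurePreserving (fun (x : ι × κ → Ω) i k => x (i, k))
      (Measure.pi fun _ => μ) (Measure.pi fun _ => Measure.pi fun _ => μ) := by
  refine ⟨by fun_prop, ?_⟩
  have h := Measure.infinitePi_map_curry (fun (_ : ι) (_ : κ) => μ)
  simp only [Measure.infinitePi_eq_pi] at h
  exact h

/-- The transpose of a matrix with i.i.d. entries has i.i.d. entries. -/
theorem measurePreserving_transpose (μ : Measure Ω) [IsProbabilityMeasure μ] :
    MeasurePreserving (fun (x : ι → κ → Ω) k i => x i k)
      (Measure.pi fun _ => Measure.pi fun _ => μ) (Measure.pi fun _ => Measure.pi fun _ => μ) := by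
  refine ⟨by fun_prop, ?_⟩
  rw [← (measurePreserving_curry (ι := ι) (κ := κ) μ).map_eq, Measure.map_map (by fun_prop)
    (by fun_prop)]
  exact ((measurePreserving_curry μ).comp
    (measurePreserving_comp_equiv μ (Equiv.prodComm κ ι))).map_eq

end PiMeasure

/-! ### Zero-forcing transmission -/

section ZeroForcing

variable {ι κ : Type*} [Fintype ι] [DecidableEq ι] [Fintype κ] [DecidableEq κ] {M : ℕ}

/-- The squared Frobenius norm of the pseudoinverse. It is the trace of `(F Fᴴ)⁻¹` and determines the
signal-to-noise ratio of all the honest users. If `F Fᴴ` is singular, it is `0` (a junk value). -/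
noncomputable def zfPower (F : Matrix ι (Fin M) ℂ) : ℝ :=
  ∑ k, ∑ m, ‖zfMatrix F m k‖ ^ 2

/-- The rate of every honest user of a group with reported channel matrix `F`. For singular `F Fᴴ` it
is `0`. -/
noncomputable def zfRate (P σ : ℝ) (F : Matrix ι (Fin M) ℂ) : ℝ :=
  Real.logb 2 (1 + P / zfPower F / σ ^ 2)

theorem zfMatrix_eq_zero {F : Matrix ι (Fin M) ℂ} (h : ¬ IsUnit (F * Fᴴ).det) :
    zfMatrix F = 0 := by
  rw [zfMatrix, Matrix.nonsing_inv_apply_not_isUnit _ h, Matrix.mul_zero]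

theorem mul_zfMatrix {F : Matrix ι (Fin M) ℂ} (h : IsUnit (F * Fᴴ).det) :
    F * zfMatrix F = 1 := by
  rw [zfMatrix, ← Matrix.mul_assoc, Matrix.mul_nonsing_inv _ h]

theorem zfPower_nonneg (F : Matrix ι (Fin M) ℂ) : 0 ≤ zfPower F := by
  unfold zfPower; positivity

theorem zfPower_eq_zero {F : Matrix ι (Fin M) ℂ} (h : ¬ IsUnit (F * Fᴴ).det) :
    zfPower F = 0 := by
  simp [zfPower, zfMatrix_eq_zero h]

theorem zfPower_eq_trace {F : Matrix ι (Fin M) ℂ} (h : IsUnit (F * Fᴴ).det) :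
    zfPower F = (((F * Fᴴ)⁻¹).trace).re := by
  have h1 : (zfMatrix F)ᴴ * zfMatrix F = (F * Fᴴ)⁻¹ := by
    rw [zfMatrix, Matrix.conjTranspose_mul, Matrix.conjTranspose_conjTranspose, Matrix.mul_assoc,
      ← Matrix.mul_assoc F, Matrix.mul_nonsing_inv _ h, Matrix.mul_one,
      Matrix.conjTranspose_nonsing_inv, Matrix.conjTranspose_mul,
      Matrix.conjTranspose_conjTranspose]
  rw [← h1, Matrix.trace, zfPower, Complex.re_sum]
  refine Finset.sum_congr rfl fun k _ => ?_
  rw [Matrix.diag_apply, Matrix.mul_apply, Complex.re_sum]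
  refine Finset.sum_congr rfl fun m _ => ?_
  rw [Matrix.conjTranspose_apply, Complex.star_def, ← Complex.normSq_eq_conj_mul_self,
    Complex.normSq_eq_norm_sq, Complex.ofReal_re]

theorem zfMatrix_submatrix (F : Matrix ι (Fin M) ℂ) (e : κ ≃ ι) :
    zfMatrix (F.submatrix e id) = (zfMatrix F).submatrix id e := by
  rw [zfMatrix, zfMatrix, Matrix.conjTranspose_submatrix,
    ← Matrix.submatrix_mul _ _ _ _ _ Function.bijective_id, Matrix.inv_submatrix_equiv,
    Matrix.submatrix_mul _ _ _ _ _ e.bijective]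

theorem zfRate_submatrix (P σ : ℝ) (F : Matrix ι (Fin M) ℂ) (e : κ ≃ ι) :
    zfRate P σ (F.submatrix e id) = zfRate P σ F := by
  rw [zfRate, zfRate]
  congr 4
  simp only [zfPower, zfMatrix_submatrix]
  exact e.sum_comp fun k => ∑ m, ‖zfMatrix F m k‖ ^ 2

theorem zfMatrix_diagonal_mul (G : Matrix ι (Fin M) ℂ) {a : ι → ℂ} (ha : ∀ k, a k ≠ 0) :
    zfMatrix (Matrix.diagonal a * G) = zfMatrix G * Matrix.diagonal (fun k => (a k)⁻¹) := by
  have hD : IsUnit (Matrix.diagonal a).det := by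
    rw [Matrix.det_diagonal]
    exact (Finset.prod_ne_zero_iff.2 fun k _ => ha k).isUnit
  have hD' : IsUnit (Matrix.diagonal a)ᴴ.det := by
    rw [Matrix.det_conjTranspose]; exact hD.star
  have hinv : (Matrix.diagonal a)⁻¹ = Matrix.diagonal (fun k => (a k)⁻¹) := by
    refine Matrix.inv_eq_right_inv ?_
    rw [Matrix.diagonal_mul_diagonal, ← Matrix.diagonal_one]
    congr 1; ext k; exact mul_inv_cancel₀ (ha k)
  rw [zfMatrix, zfMatrix, Matrix.conjTranspose_mul,
    show Matrix.diagonal a * G * (Gᴴ * (Matrix.diagonal a)ᴴ) =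
      Matrix.diagonal a * (G * Gᴴ) * (Matrix.diagonal a)ᴴ by simp only [Matrix.mul_assoc],
    Matrix.mul_inv_rev, Matrix.mul_inv_rev, hinv, Matrix.mul_assoc,
    ← Matrix.mul_assoc (Matrix.diagonal a)ᴴ, Matrix.mul_nonsing_inv _ hD', Matrix.one_mul,
    Matrix.mul_assoc]

theorem zfPower_diagonal_mul (G : Matrix ι (Fin M) ℂ) {a : ι → ℂ} (ha : ∀ k, a k ≠ 0) :
    zfPower (Matrix.diagonal a * G) = ∑ k, (‖a k‖ ^ 2)⁻¹ * ∑ m, ‖zfMatrix G m k‖ ^ 2 := by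
  rw [zfPower, zfMatrix_diagonal_mul G ha]
  refine Finset.sum_congr rfl fun k _ => ?_
  rw [Finset.mul_sum]
  refine Finset.sum_congr rfl fun m _ => ?_
  rw [Matrix.mul_diagonal, norm_mul, norm_inv, mul_pow, inv_pow, mul_comm]

theorem effectiveGain_sq (F : Matrix ι (Fin M) ℂ) (k : ι) :
    effectiveGain F k ^ 2 = (∑ m, ‖zfMatrix F m k‖ ^ 2)⁻¹ := by
  rw [effectiveGain, div_pow, one_pow, Real.sq_sqrt (by positivity), one_div]

/-- With the max-min power control all honest users have the same signal-to-noise ratio. -/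
theorem receivedSNR_eq {P : ℝ} (hP : 0 ≤ P) (σ : ℝ) (F G : Matrix ι (Fin M) ℂ) (k : ι)
    (hk : F k = G k) : receivedSNR P σ F G k = P / zfPower F / σ ^ 2 := by
  have hGF : (G * zfMatrix F) k k = (F * zfMatrix F) k k := by
    simp only [Matrix.mul_apply, ← hk]
  rw [receivedSNR]
  congr 1
  rw [receivedMatrix, Matrix.mul_diagonal, Matrix.mul_diagonal, hGF]
  by_cases h : IsUnit (F * Fᴴ).det
  · have hpow : ∑ j, 1 / effectiveGain F j ^ 2 = zfPower F := by
      simp only [effectiveGain_sq, one_div, inv_inv, zfPower]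
    have hne : effectiveGain F k ^ 2 ≠ 0 := by
      rw [effectiveGain_sq]
      intro h0
      have h0 := inv_eq_zero.1 h0
      have h1 : (F * zfMatrix F) k k = 1 := by rw [mul_zfMatrix h, Matrix.one_apply_eq]
      rw [Finset.sum_eq_zero_iff_of_nonneg (fun _ _ => by positivity)] at h0
      rw [Matrix.mul_apply, Finset.sum_eq_zero] at h1
      · exact zero_ne_one h1
      · intro m hm
        have := h0 m hm
        simp only [ne_eq, OfNat.ofNat_ne_zero, not_false_eq_true, pow_eq_zero_iff,
          norm_eq_zero] at this
        rw [this, mul_zero]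
    have hpos : 0 ≤ userPower P F k := by
      rw [userPower, hpow]
      have := zfPower_nonneg F
      positivity
    rw [mul_zfMatrix h, Matrix.one_apply_eq, one_mul, norm_mul, mul_pow, Complex.norm_real,
      Complex.norm_real, Real.norm_eq_abs, Real.norm_eq_abs, sq_abs, sq_abs, Real.sq_sqrt hpos,
      userPower, hpow]
    have hne' : effectiveGain F k ≠ 0 := fun h0 => hne (by simp [h0])
    field_simp
  · simp [zfMatrix_eq_zero h, zfPower_eq_zero h]

/-- By Cauchy-Schwarz applied to the trace of `F W = 1`. -/
theorem card_sq_le_mul_zfPower {F : Matrix ι (Fin M) ℂ} (h : IsUnit (F * Fᴴ).det) :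
    (Fintype.card ι : ℝ) ^ 2 ≤ (∑ k, ∑ m, ‖F k m‖ ^ 2) * zfPower F := by
  have h1 : (Fintype.card ι : ℝ) ≤ ∑ p : ι × Fin M, ‖F p.1 p.2‖ * ‖zfMatrix F p.2 p.1‖ := by
    have : ∀ k, (1 : ℝ) ≤ ∑ m, ‖F k m‖ * ‖zfMatrix F m k‖ := by
      intro k
      have h1 : (F * zfMatrix F) k k = 1 := by rw [mul_zfMatrix h, Matrix.one_apply_eq]
      calc (1 : ℝ) = ‖(F * zfMatrix F) k k‖ := by rw [h1, norm_one]
        _ ≤ ∑ m, ‖F k m * zfMatrix F m k‖ := by rw [Matrix.mul_apply]; exact norm_sum_le _ _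
        _ = _ := by simp only [norm_mul]
    rw [Fintype.sum_prod_type]
    calc (Fintype.card ι : ℝ) = ∑ _k : ι, (1 : ℝ) := by simp
      _ ≤ _ := Finset.sum_le_sum fun k _ => this k
  have h2 := Finset.sum_mul_sq_le_sq_mul_sq (Finset.univ : Finset (ι × Fin M))
    (fun p => ‖F p.1 p.2‖) (fun p => ‖zfMatrix F p.2 p.1‖)
  rw [Fintype.sum_prod_type (fun p : ι × Fin M => ‖F p.1 p.2‖ ^ 2),
    Fintype.sum_prod_type (fun p : ι × Fin M => ‖zfMatrix F p.2 p.1‖ ^ 2)] at h2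
  exact le_trans (pow_le_pow_left₀ (by positivity) h1 2) h2

theorem zfRate_nonneg {P : ℝ} (hP : 0 ≤ P) (σ : ℝ) (F : Matrix ι (Fin M) ℂ) :
    0 ≤ zfRate P σ F := by
  refine Real.logb_nonneg one_lt_two ?_
  have : 0 ≤ P / zfPower F / σ ^ 2 := by have := zfPower_nonneg F; positivity
  linarith

/-- An upper bound that holds for singular `F Fᴴ` as well, and makes the rates integrable. -/
theorem zfRate_le {P : ℝ} (hP : 0 ≤ P) (σ : ℝ) (F : Matrix ι (Fin M) ℂ) :
    zfRate P σ F ≤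
      Real.logb 2 (1 + P * (∑ k, ∑ m, ‖F k m‖ ^ 2) / (Fintype.card ι : ℝ) ^ 2 / σ ^ 2) := by
  have h0 : 0 ≤ P / zfPower F / σ ^ 2 := by have := zfPower_nonneg F; positivity
  refine Real.logb_le_logb_of_le one_lt_two (by linarith) ?_
  gcongr 1 + ?_ / _
  have hS : 0 ≤ ∑ k, ∑ m, ‖F k m‖ ^ 2 := by positivity
  by_cases h : IsUnit (F * Fᴴ).det
  · rcases isEmpty_or_nonempty ι with hι | hι
    · simp [zfPower]
    have h1 := card_sq_le_mul_zfPower h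
    have hn : (0 : ℝ) < (Fintype.card ι : ℝ) ^ 2 := by
      have : 0 < Fintype.card ι := Fintype.card_pos
      positivity
    have hpos : 0 < zfPower F := by
      refine lt_of_le_of_ne (zfPower_nonneg F) fun h2 => ?_
      rw [← h2, mul_zero] at h1
      linarith
    rw [div_le_div_iff₀ hpos hn, mul_assoc]
    gcongr
  · rw [zfPower_eq_zero h, div_zero]; positivity

end ZeroForcing

/-! ### The rates of a group -/

section GroupRate

variable {K M : ℕ}

theorem groupRate_eq_zfRate {P : ℝ} (hP : 0 ≤ P) (σ : ℝ) (F G : Channel K M)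
    (honest : Fin K → Prop) [DecidablePred honest] (S : Finset (Fin K))
    (hne : ∃ k ∈ S, honest k) (hFG : ∀ k, honest k → F k = G k) :
    groupRate P σ F G honest S = zfRate P σ (groupRows F S) := by
  obtain ⟨k, hkS, hk⟩ := hne
  have hne : (Finset.univ.filter fun k : S => honest k).Nonempty := ⟨⟨k, hkS⟩, by simpa using hk⟩
  rw [groupRate, Finset.expect_congr rfl fun k hk => ?_, Finset.expect_const hne]
  rw [receivedSNR_eq hP, zfRate]
  exact hFG k (Finset.mem_filter.1 hk).2

theorem groupRate_accurate {P : ℝ} (hP : 0 ≤ P) (σ : ℝ) (G : Channel K M) (S : Finset (Fin K)) :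
    groupRate P σ G G (fun _ => True) S = zfRate P σ (groupRows G S) := by
  rcases S.eq_empty_or_nonempty with rfl | ⟨k, hk⟩
  · simp [groupRate, zfRate, zfPower]
  · exact groupRate_eq_zfRate hP σ G G _ S ⟨k, hk, trivial⟩ fun _ _ => rfl

theorem zfRate_reindex (P σ : ℝ) (G : Channel K M) (e : Fin K ≃ Fin K) {S S' : Finset (Fin K)}
    (f : S ≃ S') (hf : ∀ k : S, e k = (f k : Fin K)) :
    zfRate P σ (groupRows (fun k => G (e k)) S) = zfRate P σ (groupRows G S') := by
  rw [← zfRate_submatrix P σ (groupRows G S') f]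
  congr 1
  ext k m
  simp [groupRows, hf]

theorem reportedChannel_honest {KM : ℕ} (δ : ℝ) (G : Channel K M) {k : Fin K}
    (hk : ¬ (k : ℕ) < KM) : reportedChannel KM δ G k = G k := by
  ext m; simp [reportedChannel, hk]

theorem channelMagnitude_reportedChannel (KM : ℕ) {δ : ℝ} (hδ : 0 ≤ δ) (G : Channel K M)
    (k : Fin K) : channelMagnitude (reportedChannel KM δ G) k =
      (if (k : ℕ) < KM then δ else 1) * channelMagnitude G k := by
  rw [channelMagnitude, channelMagnitude, Finset.mul_sum]
  refine Finset.sum_congr rfl fun m _ => ?_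
  rw [reportedChannel, norm_mul, mul_pow, Complex.norm_real, Real.norm_eq_abs, sq_abs]
  split_ifs
  · rw [Real.sq_sqrt hδ]
  · rw [one_pow]

/-- Underreporting increases the total power of the precoder, by the factor `1 / δ` at most. -/
theorem zfPower_reportedChannel (KM : ℕ) {δ : ℝ} (hδ : 0 < δ) (hδ1 : δ < 1) (G : Channel K M)
    (S : Finset (Fin K)) :
    zfPower (groupRows G S) ≤ zfPower (groupRows (reportedChannel KM δ G) S) ∧
      zfPower (groupRows (reportedChannel KM δ G) S) ≤ δ⁻¹ * zfPower (groupRows G S) := by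
  set a : S → ℂ := fun k => ((if ((k : Fin K) : ℕ) < KM then √δ else 1 : ℝ) : ℂ) with ha
  have hrow : groupRows (reportedChannel KM δ G) S = Matrix.diagonal a * groupRows G S := by
    ext k m
    rw [Matrix.diagonal_mul]
    rfl
  have hnorm : ∀ k, ‖a k‖ ^ 2 = if ((k : Fin K) : ℕ) < KM then δ else 1 := by
    intro k
    rw [ha, Complex.norm_real, Real.norm_eq_abs, sq_abs]
    split_ifs
    · rw [Real.sq_sqrt hδ.le]
    · rw [one_pow]
  have ha0 : ∀ k, a k ≠ 0 := by
    intro k h0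
    have := hnorm k
    rw [h0, norm_zero] at this
    split_ifs at this <;> norm_num at this
    exact hδ.ne this
  rw [hrow, zfPower_diagonal_mul _ ha0, zfPower, Finset.mul_sum]
  have hδ' : 1 ≤ δ⁻¹ := (one_le_inv₀ hδ).2 hδ1.le
  constructor <;> refine Finset.sum_le_sum fun k _ => ?_
  · refine le_mul_of_one_le_left (by positivity) ?_
    rw [hnorm]
    split_ifs
    · exact hδ'
    · rw [inv_one]
  · refine mul_le_mul_of_nonneg_right ?_ (by positivity)
    rw [hnorm]
    split_ifs
    · exact le_rfl
    · rwa [inv_one]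

theorem abs_logb_one_add_mul_sub_le {a u : ℝ} (ha : 0 ≤ a) (hu : 0 < u) :
    |Real.logb 2 (1 + a * u) - Real.logb 2 (1 + a)| ≤ |Real.logb 2 u| := by
  have ha1 : 0 < 1 + a := by linarith
  have hau : 0 < 1 + a * u := by positivity
  have hlog : Real.logb 2 (u * (1 + a)) = Real.logb 2 u + Real.logb 2 (1 + a) :=
    Real.logb_mul hu.ne' ha1.ne'
  rcases le_total 1 u with h | h
  · have h1 : Real.logb 2 (1 + a) ≤ Real.logb 2 (1 + a * u) :=
      Real.logb_le_logb_of_le one_lt_two ha1 (by nlinarith)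
    have h2 : Real.logb 2 (1 + a * u) ≤ Real.logb 2 (u * (1 + a)) :=
      Real.logb_le_logb_of_le one_lt_two hau (by nlinarith)
    rw [abs_of_nonneg (by linarith)]
    exact le_trans (by linarith) (le_abs_self _)
  · have h1 : Real.logb 2 (1 + a * u) ≤ Real.logb 2 (1 + a) :=
      Real.logb_le_logb_of_le one_lt_two hau (by nlinarith)
    have h2 : Real.logb 2 (u * (1 + a)) ≤ Real.logb 2 (1 + a * u) :=
      Real.logb_le_logb_of_le one_lt_two (by positivity) (by nlinarith)
    rw [abs_of_nonpos (by linarith)]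
    exact le_trans (by linarith) (neg_le_abs _)

/-- Underreporting by other users costs an honest user at most the constant `log₂ (1 / δ)`. -/
theorem zfRate_reportedChannel {P : ℝ} (hP : 0 ≤ P) (σ : ℝ) (KM : ℕ) {δ : ℝ} (hδ : 0 < δ)
    (hδ1 : δ < 1) (G : Channel K M) (S : Finset (Fin K)) :
    zfRate P σ (groupRows (reportedChannel KM δ G) S) ≤ zfRate P σ (groupRows G S) ∧
      |zfRate P σ (groupRows (reportedChannel KM δ G) S) - zfRate P σ (groupRows G S)| ≤
        |Real.logb 2 δ| := by
  obtain ⟨h1, h2⟩ := zfPower_reportedChannel KM hδ hδ1 G S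
  have hx0 := zfPower_nonneg (groupRows G S)
  rw [zfRate, zfRate]
  generalize zfPower (groupRows G S) = x at h1 h2 hx0 ⊢
  generalize zfPower (groupRows (reportedChannel KM δ G) S) = y at h1 h2 ⊢
  rcases hx0.eq_or_lt with h0 | h0
  · have : y = 0 := le_antisymm (by rw [← h0, mul_zero] at h2; exact h2) (h0 ▸ h1)
    rw [this, ← h0]
    simp
  have hy0 : 0 < y := h0.trans_le h1
  have ha : 0 ≤ P / x / σ ^ 2 := by positivity
  have hu : P / y / σ ^ 2 = P / x / σ ^ 2 * (x / y) := by field_simp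
  rw [hu]
  generalize P / x / σ ^ 2 = a at ha ⊢
  have hxy : x / y ≤ 1 := (div_le_one hy0).2 h1
  have hδxy : δ ≤ x / y := by
    rw [le_div_iff₀ hy0]
    calc δ * y ≤ δ * (δ⁻¹ * x) := by gcongr
      _ = x := by field_simp
  refine ⟨Real.logb_le_logb_of_le one_lt_two (by positivity)
    (by linarith [mul_le_of_le_one_right ha hxy]), ?_⟩
  refine (abs_logb_one_add_mul_sub_le ha (by positivity)).trans ?_
  rw [abs_of_nonpos (Real.logb_nonpos one_lt_two (by positivity) hxy),
    abs_of_nonpos (Real.logb_nonpos one_lt_two (by positivity) hδ1.le)]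
  exact neg_le_neg (Real.logb_le_logb_of_le one_lt_two hδ hδxy)

end GroupRate

/-! ### Channel hardening -/

section Hardening

variable {K M : ℕ}

/-- The normalized Gram matrix `G Gᴴ / (β M)` of the channel vectors. -/
noncomputable def normalizedGram (β : ℝ) (G : Channel K M) : Matrix (Fin K) (Fin K) ℂ :=
  Matrix.of fun j k => (∑ m, G j m * star (G k m)) / ((β * M : ℝ) : ℂ)

/-- The squared Frobenius distance of the normalized Gram matrix from the identity. -/
noncomputable def gramError (β : ℝ) (G : Channel K M) : ℝ :=
  ∑ j, ∑ k, ‖normalizedGram β G j k - (1 : Matrix (Fin K) (Fin K) ℂ) j k‖ ^ 2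

/-- The rate of a group of `n` users whose channel vectors are orthogonal with squared norm `β M`. -/
noncomputable def hardenedRate (n : ℕ) (β P σ : ℝ) (M : ℕ) : ℝ :=
  Real.logb 2 (1 + P * (β * M) / n / σ ^ 2)

theorem gramError_nonneg (β : ℝ) (G : Channel K M) : 0 ≤ gramError β G := by
  unfold gramError; positivity

theorem sq_norm_normalizedGram_sub_le (β : ℝ) (G : Channel K M) (j k : Fin K) :
    ‖normalizedGram β G j k - (1 : Matrix (Fin K) (Fin K) ℂ) j k‖ ^ 2 ≤ gramError β G := by
  refine le_trans ?_ (Finset.single_le_sum (f := fun j => ∑ k, ‖normalizedGram β G j k -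
    (1 : Matrix (Fin K) (Fin K) ℂ) j k‖ ^ 2) (fun _ _ => by positivity) (Finset.mem_univ j))
  exact Finset.single_le_sum (f := fun k => ‖normalizedGram β G j k -
    (1 : Matrix (Fin K) (Fin K) ℂ) j k‖ ^ 2) (fun _ _ => by positivity) (Finset.mem_univ k)

theorem normalizedGram_self (β : ℝ) (G : Channel K M) (k : Fin K) :
    normalizedGram β G k k = ((channelMagnitude G k / (β * M) : ℝ) : ℂ) := by
  simp only [normalizedGram, Matrix.of_apply, channelMagnitude, Complex.ofReal_div,
    Complex.ofReal_sum]
  congr 1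
  refine Finset.sum_congr rfl fun m _ => ?_
  rw [Complex.star_def, Complex.mul_conj, Complex.normSq_eq_norm_sq]

theorem sq_channelMagnitude_div_sub_le (β : ℝ) (G : Channel K M) (k : Fin K) :
    (channelMagnitude G k / (β * M) - 1) ^ 2 ≤ gramError β G := by
  have h := sq_norm_normalizedGram_sub_le β G k k
  rw [normalizedGram_self, Matrix.one_apply_eq, ← Complex.ofReal_one, ← Complex.ofReal_sub,
    Complex.norm_real, Real.norm_eq_abs, sq_abs] at h
  exact h

theorem groupRows_mul_conjTranspose {β : ℝ} (hβ : 0 < β) (hM : 0 < M) (G : Channel K M)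
    (S : Finset (Fin K)) : groupRows G S * (groupRows G S)ᴴ =
      ((β * M : ℝ) : ℂ) • (normalizedGram β G).submatrix (fun k : S => (k : Fin K))
        (fun k : S => (k : Fin K)) := by
  have hM' : (0 : ℝ) < M := by exact_mod_cast hM
  have h : ((β * M : ℝ) : ℂ) ≠ 0 := Complex.ofReal_ne_zero.2 (by positivity)
  ext j k
  rw [Matrix.mul_apply, Matrix.smul_apply, Matrix.submatrix_apply, normalizedGram,
    Matrix.of_apply, smul_eq_mul, mul_div_cancel₀ _ h]
  rfl

theorem exists_forall_of_eventually_nhds_matrix {ι : Type*} [Fintype ι] {A : Matrix ι ι ℂ}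
    {p : Matrix ι ι ℂ → Prop} (h : ∀ᶠ X in 𝓝 A, p X) :
    ∃ ε > 0, ∀ X, (∀ j k, ‖X j k - A j k‖ < ε) → p X := by
  have h : ∀ᶠ X : ι → ι → ℂ in 𝓝 (fun j k => A j k), p (Matrix.of X) := h
  obtain ⟨ε, hε, hball⟩ := Metric.eventually_nhds_iff.1 h
  refine ⟨ε, hε, fun X hX => hball (y := fun j k => X j k) ?_⟩
  refine (dist_pi_lt_iff hε).2 fun j => (dist_pi_lt_iff hε).2 fun k => ?_
  rw [dist_eq_norm]
  exact hX j k

/-- If the normalized Gram matrix is close to the identity, then the rate of every group of `n` users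
is close to `hardenedRate`: the matrix inverse is continuous at the identity. -/
theorem exists_abs_zfRate_sub_le_of_gramError_lt {n : ℕ} (hn : 0 < n) {β P : ℝ} (hβ : 0 < β)
    (hP : 0 < P) (σ : ℝ) (S : Finset (Fin K)) (hS : S.card = n) {η : ℝ} (hη : 0 < η) :
    ∃ ε > 0, ∀ M, 0 < M → ∀ G : Channel K M, gramError β G < ε →
      |zfRate P σ (groupRows G S) - hardenedRate n β P σ M| ≤ η := by
  have hn' : (0 : ℝ) < n := by exact_mod_cast hn
  have hinv : ContinuousAt (fun X : Matrix S S ℂ => X⁻¹) 1 := by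
    refine continuousAt_matrix_inv _ ?_
    rw [Matrix.det_one, Ring.inverse_eq_inv']
    exact continuousAt_inv₀ one_ne_zero
  have htr : ContinuousAt (fun X : Matrix S S ℂ => (X⁻¹.trace).re) 1 :=
    Complex.continuous_re.continuousAt.comp
      ((continuous_id.matrix_trace (n := S) (R := ℂ)).continuousAt.comp hinv)
  have hval : ((1 : Matrix S S ℂ)⁻¹.trace).re = n := by
    rw [inv_one, Matrix.trace_one, Fintype.card_coe, hS, Complex.natCast_re]
  have hev1 : ∀ᶠ X in 𝓝 (1 : Matrix S S ℂ), X.det ≠ 0 :=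
    (continuous_id.matrix_det (n := S) (R := ℂ)).continuousAt.eventually_ne (by simp)
  have hev2 : ∀ᶠ X in 𝓝 (1 : Matrix S S ℂ), 0 < (X⁻¹.trace).re :=
    htr.eventually_const_lt (by beta_reduce; rw [hval]; exact hn')
  have hev3 : ∀ᶠ X in 𝓝 (1 : Matrix S S ℂ), |Real.logb 2 (n / (X⁻¹.trace).re)| < η := by
    have h1 : ContinuousAt (fun X : Matrix S S ℂ => |Real.logb 2 (n / (X⁻¹.trace).re)|) 1 := by
      refine ContinuousAt.abs ?_
      simp only [Real.logb]
      refine ContinuousAt.div_const (ContinuousAt.log (ContinuousAt.div₀ continuousAt_const htr ?_) ?_) _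
      · rw [hval]; exact hn'.ne'
      · rw [hval, div_self hn'.ne']; exact one_ne_zero
    refine h1.eventually_lt_const ?_
    beta_reduce
    rw [hval, div_self hn'.ne', Real.logb_one, abs_zero]
    exact hη
  obtain ⟨ε, hε, hball⟩ := exists_forall_of_eventually_nhds_matrix (hev1.and (hev2.and hev3))
  refine ⟨ε ^ 2, by positivity, fun M hM G hG => ?_⟩
  have hM' : (0 : ℝ) < M := by exact_mod_cast hM
  set X : Matrix S S ℂ := (normalizedGram β G).submatrix (fun k : S => (k : Fin K))
    (fun k : S => (k : Fin K)) with hX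
  obtain ⟨hX1, hX2, hX3⟩ := hball X (by
    intro j k
    refine lt_of_pow_lt_pow_left₀ 2 hε.le (lt_of_le_of_lt ?_ hG)
    refine le_trans (le_of_eq ?_) (sq_norm_normalizedGram_sub_le β G j k)
    rw [hX, Matrix.submatrix_apply, Matrix.one_apply, Matrix.one_apply]
    simp only [Subtype.ext_iff])
  have hgram := groupRows_mul_conjTranspose hβ hM G S
  rw [← hX] at hgram
  have hc : ((β * M : ℝ) : ℂ) ≠ 0 := Complex.ofReal_ne_zero.2 (by positivity)
  have hunit : IsUnit (groupRows G S * (groupRows G S)ᴴ).det := by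
    rw [hgram, Matrix.det_smul]
    exact (mul_ne_zero (pow_ne_zero _ hc) hX1).isUnit
  have hpow : zfPower (groupRows G S) = (β * M)⁻¹ * (X⁻¹.trace).re := by
    rw [zfPower_eq_trace hunit, hgram]
    have hinv : (((β * M : ℝ) : ℂ) • X)⁻¹ = ((β * M : ℝ) : ℂ)⁻¹ • X⁻¹ := by
      refine Matrix.inv_eq_right_inv ?_
      rw [Matrix.smul_mul, Matrix.mul_smul, smul_smul, mul_inv_cancel₀ hc, one_smul,
        Matrix.mul_nonsing_inv _ hX1.isUnit]
    rw [hinv, Matrix.trace_smul, smul_eq_mul, ← Complex.ofReal_inv, Complex.re_ofReal_mul]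
  have hrate : zfRate P σ (groupRows G S) =
      Real.logb 2 (1 + P * (β * M) / n / σ ^ 2 * (n / (X⁻¹.trace).re)) := by
    rw [zfRate, hpow]
    congr 2
    field_simp
  rw [hrate, hardenedRate]
  exact (abs_logb_one_add_mul_sub_le (by positivity) (by positivity)).trans hX3.le

theorem hardenedRate_nonneg (n : ℕ) {β P : ℝ} (hβ : 0 < β) (hP : 0 < P) (σ : ℝ) (M : ℕ) :
    0 ≤ hardenedRate n β P σ M :=
  Real.logb_nonneg one_lt_two (by
    have : 0 ≤ P * (β * M) / n / σ ^ 2 := by positivity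
    linarith)

theorem logb_one_add_le {x : ℝ} (hx : 0 ≤ x) : Real.logb 2 (1 + x) ≤ x / Real.log 2 := by
  rw [Real.logb]
  have := Real.log_le_sub_one_of_pos (show 0 < 1 + x by linarith)
  have h2 := Real.log_pos one_lt_two
  gcongr
  linarith

/-- A crude bound that holds for all channels. -/
theorem abs_zfRate_sub_hardenedRate_le {n : ℕ} (hn : 0 < n) {β P : ℝ} (hβ : 0 < β)
    (hP : 0 < P) (σ : ℝ) (S : Finset (Fin K)) (hS : S.card = n) (hM : 0 < M) (G : Channel K M) :
    |zfRate P σ (groupRows G S) - hardenedRate n β P σ M| ≤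
      hardenedRate n β P σ M + (2 + gramError β G) / Real.log 2 := by
  have hn' : (0 : ℝ) < n := by exact_mod_cast hn
  have hM' : (0 : ℝ) < M := by exact_mod_cast hM
  have hV := gramError_nonneg β G
  have hc := hardenedRate_nonneg n hβ hP σ M
  have hlog := Real.log_pos one_lt_two
  set x : ℝ := (∑ k : S, ∑ m, ‖groupRows G S k m‖ ^ 2) / (n * (β * M)) with hx
  have hx0 : 0 ≤ x := by positivity
  have hx2 : x ≤ 2 + gramError β G := by
    rw [hx, div_le_iff₀ (by positivity)]
    have : ∀ k : S, ∑ m, ‖groupRows G S k m‖ ^ 2 ≤ (2 + gramError β G) * (β * M) := by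
      intro k
      have h1 := sq_channelMagnitude_div_sub_le β G k
      rw [← div_le_iff₀ (by positivity)]
      change channelMagnitude G k / (β * M) ≤ _
      nlinarith [sq_nonneg (channelMagnitude G k / (β * M) - 1 - 1)]
    refine (Finset.sum_le_sum fun k _ => this k).trans (le_of_eq ?_)
    rw [Finset.sum_const, Finset.card_univ, Fintype.card_coe, hS, nsmul_eq_mul]
    ring
  have hup : zfRate P σ (groupRows G S) ≤
      hardenedRate n β P σ M + (2 + gramError β G) / Real.log 2 := by
    refine (zfRate_le hP.le σ _).trans ?_
    set a := P * (β * M) / n / σ ^ 2 with ha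
    have ha0 : 0 ≤ a := by positivity
    have hax : P * (∑ k : S, ∑ m, ‖groupRows G S k m‖ ^ 2) / (Fintype.card S : ℝ) ^ 2 / σ ^ 2 =
        a * x := by
      rw [Fintype.card_coe, hS, hx, ha]
      field_simp
    rw [hax]
    calc Real.logb 2 (1 + a * x) ≤ Real.logb 2 ((1 + a) * (1 + x)) :=
          Real.logb_le_logb_of_le one_lt_two (by positivity) (by nlinarith)
      _ = Real.logb 2 (1 + a) + Real.logb 2 (1 + x) :=
          Real.logb_mul (by positivity) (by positivity)
      _ ≤ _ := by
          have := logb_one_add_le hx0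
          rw [hardenedRate, ← ha]
          gcongr
          exact this.trans (by gcongr)
  have h0 := zfRate_nonneg hP.le σ (groupRows G S)
  have : 0 ≤ (2 + gramError β G) / Real.log 2 := by positivity
  rw [abs_le]
  constructor <;> linarith

/-- On the rare channels with a large Gram error the rate may be as small as `0`, which costs no more
than `hardenedRate` times the Gram error, up to a constant. -/
theorem exists_abs_zfRate_sub_le {n : ℕ} (hn : 0 < n) {β P : ℝ} (hβ : 0 < β)
    (hP : 0 < P) (σ : ℝ) (S : Finset (Fin K)) (hS : S.card = n) {η : ℝ} (hη : 0 < η) :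
    ∃ C, 0 ≤ C ∧ ∀ M, 0 < M → ∀ G : Channel K M,
      |zfRate P σ (groupRows G S) - hardenedRate n β P σ M| ≤
        η + C * ((1 + hardenedRate n β P σ M) * gramError β G) := by
  obtain ⟨ε, hε, hgood⟩ := exists_abs_zfRate_sub_le_of_gramError_lt hn hβ hP σ S hS hη
  have hlog := Real.log_pos one_lt_two
  refine ⟨1 / ε + (2 / ε + 1) / Real.log 2, by positivity, fun M hM G => ?_⟩
  have hc := hardenedRate_nonneg n hβ hP σ M
  have hV := gramError_nonneg β G
  rcases lt_or_ge (gramError β G) ε with h | h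
  · exact (hgood M hM G h).trans (le_add_of_nonneg_right (by positivity))
  · refine (abs_zfRate_sub_hardenedRate_le hn hβ hP σ S hS hM G).trans ?_
    set c := hardenedRate n β P σ M
    set V := gramError β G
    have h1 : 1 ≤ V / ε := (one_le_div hε).2 h
    have h2 : (2 + V) / Real.log 2 ≤ (2 / ε + 1) / Real.log 2 * V := by
      rw [div_mul_eq_mul_div]
      gcongr
      calc 2 + V ≤ 2 * (V / ε) + V := by linarith
        _ = (2 / ε + 1) * V := by ring
    have h3 : c ≤ c * (V / ε) := le_mul_of_one_le_right hc h1
    have h4 : 0 ≤ c * ((2 / ε + 1) / Real.log 2 * V) := by positivity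
    have h5 : 0 ≤ V / ε := by positivity
    calc c + (2 + V) / Real.log 2
        ≤ c * (V / ε) + (2 / ε + 1) / Real.log 2 * V := add_le_add h3 h2
      _ ≤ η + (c * (V / ε) + (2 / ε + 1) / Real.log 2 * V + V / ε +
            c * ((2 / ε + 1) / Real.log 2 * V)) := by linarith
      _ = _ := by ring

theorem exists_forall_abs_zfRate_sub_le (K : ℕ) {n : ℕ} (hn : 0 < n) {β P : ℝ} (hβ : 0 < β)
    (hP : 0 < P) (σ : ℝ) {η : ℝ} (hη : 0 < η) :
    ∃ C, 0 ≤ C ∧ ∀ M, 0 < M → ∀ G : Channel K M, ∀ S : Finset (Fin K), S.card = n →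
      |zfRate P σ (groupRows G S) - hardenedRate n β P σ M| ≤
        η + C * ((1 + hardenedRate n β P σ M) * gramError β G) := by
  have h := fun S : {S : Finset (Fin K) // S.card = n} =>
    exists_abs_zfRate_sub_le hn hβ hP σ S.1 S.2 hη
  choose C hC0 hC using h
  refine ⟨∑ S, C S, Finset.sum_nonneg fun S _ => hC0 S, fun M hM G S hS => ?_⟩
  refine (hC ⟨S, hS⟩ M hM G).trans ?_
  have hc := hardenedRate_nonneg n hβ hP σ M
  have hV := gramError_nonneg β G
  gcongr
  exact Finset.single_le_sum (fun S _ => hC0 S) (Finset.mem_univ _)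

end Hardening

/-! ### Moments of the channel -/

section Moments

theorem measurable_complex_mk : Measurable (fun p : ℝ × ℝ => (⟨p.1, p.2⟩ : ℂ)) :=
  Complex.measurableEquivRealProd.symm.measurable

instance (β : ℝ) : IsProbabilityMeasure (complexGaussian β) :=
  Measure.isProbabilityMeasure_map measurable_complex_mk.aemeasurable

instance (K M : ℕ) (β : ℝ) : IsProbabilityMeasure (channelLaw K M β) := by
  unfold channelLaw; infer_instance

theorem memLp_four_complexGaussian (β : ℝ) : MemLp (fun z => z) 4 (complexGaussian β) := by
  have h := memLp_id_gaussianReal' (μ := 0) (v := (β / 2).toNNReal) 4 (by simp)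
  rw [complexGaussian, memLp_map_measure_iff (by fun_prop) measurable_complex_mk.aemeasurable]
  have h1 := (h.comp_fst (gaussianReal 0 (β / 2).toNNReal)).norm
  have h2 := (h.comp_snd (gaussianReal 0 (β / 2).toNNReal)).norm
  refine (h1.add h2).of_le measurable_complex_mk.aestronglyMeasurable (.of_forall fun p => ?_)
  refine (Complex.norm_le_abs_re_add_abs_im _).trans ?_
  simp only [id, Pi.add_apply, Function.comp_apply, Real.norm_eq_abs]
  exact le_abs_self _

theorem integral_complexGaussian (β : ℝ) : ∫ z, z ∂complexGaussian β = 0 := by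
  have hint : Integrable (fun z : ℂ => z) (complexGaussian β) :=
    (memLp_four_complexGaussian β).integrable (by norm_num)
  refine Complex.ext ?_ ?_
  · have := integral_re hint
    change ∫ z : ℂ, z.re ∂_ = Complex.re _ at this
    rw [← this, complexGaussian, integral_map measurable_complex_mk.aemeasurable (by fun_prop)]
    rw [integral_fun_fst (fun x : ℝ => x)]
    simp
  · have := integral_im hint
    change ∫ z : ℂ, z.im ∂_ = Complex.im _ at this
    rw [← this, complexGaussian, integral_map measurable_complex_mk.aemeasurable (by fun_prop)]
    rw [integral_fun_snd (fun x : ℝ => x)]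
    simp

theorem integral_sq_gaussianReal (v : NNReal) : ∫ x, x ^ 2 ∂gaussianReal 0 v = v := by
  have h := variance_fun_id_gaussianReal (μ := 0) (v := v)
  rwa [variance_of_integral_eq_zero (by fun_prop) (by simp)] at h

theorem integral_norm_sq_complexGaussian {β : ℝ} (hβ : 0 < β) :
    ∫ z, ‖z‖ ^ 2 ∂complexGaussian β = β := by
  have hint : Integrable (fun x : ℝ => x ^ 2) (gaussianReal 0 (β / 2).toNNReal) :=
    (memLp_id_gaussianReal' 2 (by simp)).integrable_sq
  rw [complexGaussian, integral_map measurable_complex_mk.aemeasurable (by fun_prop)]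
  have : ∀ p : ℝ × ℝ, ‖(⟨p.1, p.2⟩ : ℂ)‖ ^ 2 = p.1 ^ 2 + p.2 ^ 2 := by
    intro p
    rw [← Complex.normSq_eq_norm_sq, Complex.normSq_mk]; ring
  simp only [this]
  rw [integral_add (hint.comp_fst _) (hint.comp_snd _), integral_fun_fst (fun x : ℝ => x ^ 2),
    integral_fun_snd (fun x : ℝ => x ^ 2), integral_sq_gaussianReal]
  rw [probReal_univ, one_smul, Real.coe_toNNReal _ (by positivity), add_halves]

theorem integral_comp_measurePreserving {X Y E : Type*} [MeasurableSpace X] [MeasurableSpace Y]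
    [NormedAddCommGroup E] [NormedSpace ℝ E] {μ : Measure X} {ν : Measure Y} {f : X → Y}
    (hf : MeasurePreserving f μ ν) {g : Y → E} (hg : AEStronglyMeasurable g ν) :
    ∫ x, g (f x) ∂μ = ∫ y, g y ∂ν := by
  rw [← hf.map_eq] at hg ⊢
  exact (integral_map hf.aemeasurable hg).symm

/-- Weak law of large numbers in `L²` for a function of the columns of the channel matrix. -/
theorem integral_sq_sum_columns {K M : ℕ} {β : ℝ} {φ : (Fin K → ℂ) → ℝ}
    (hφ : MemLp φ 2 (Measure.pi fun _ : Fin K => complexGaussian β))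
    (h0 : ∫ c, φ c ∂(Measure.pi fun _ : Fin K => complexGaussian β) = 0) :
    Integrable (fun G : Channel K M => (∑ m, φ fun k => G k m) ^ 2) (channelLaw K M β) ∧
      ∫ G : Channel K M, (∑ m, φ fun k => G k m) ^ 2 ∂channelLaw K M β =
        M * ∫ c, φ c ^ 2 ∂(Measure.pi fun _ : Fin K => complexGaussian β) := by
  set ν := Measure.pi fun _ : Fin K => complexGaussian β
  have hT : MeasurePreserving (fun (G : Channel K M) m k => G k m) (channelLaw K M β)
      (Measure.pi fun _ : Fin M => ν) := measurePreserving_transpose (complexGaussian β)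
  have hcol : ∀ m : Fin M, MemLp (fun y : Fin M → Fin K → ℂ => φ (y m)) 2
      (Measure.pi fun _ : Fin M => ν) := fun m =>
    hφ.comp_measurePreserving (measurePreserving_eval (fun _ : Fin M => ν) m)
  have hsum := memLp_finsetSum Finset.univ fun m _ => hcol m
  have hcol0 : ∀ m : Fin M, ∫ y : Fin M → Fin K → ℂ, φ (y m) ∂(Measure.pi fun _ : Fin M => ν) = 0 :=
    fun m => (integral_comp_measurePreserving (measurePreserving_eval (fun _ : Fin M => ν) m)
      hφ.aestronglyMeasurable).trans h0
  have hzero : ∫ y : Fin M → Fin K → ℂ, ∑ m, φ (y m) ∂(Measure.pi fun _ : Fin M => ν) = 0 := by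
    rw [integral_finsetSum _ fun m _ => (hcol m).integrable one_le_two]
    exact Finset.sum_eq_zero fun m _ => hcol0 m
  have hvar := variance_sum_pi (μ := fun _ : Fin M => ν) (X := fun _ => φ) fun _ => hφ
  have hfun : (∑ m : Fin M, fun y : Fin M → Fin K → ℂ => φ (y m)) = fun y => ∑ m, φ (y m) := by
    ext y; simp
  rw [hfun, variance_of_integral_eq_zero hsum.aestronglyMeasurable.aemeasurable hzero,
    variance_of_integral_eq_zero hφ.aestronglyMeasurable.aemeasurable h0, Finset.sum_const,
    Finset.card_univ, Fintype.card_fin, nsmul_eq_mul] at hvar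
  refine ⟨hT.integrable_comp_of_integrable hsum.integrable_sq, ?_⟩
  rw [← hvar]
  exact integral_comp_measurePreserving hT hsum.integrable_sq.aestronglyMeasurable

variable {K : ℕ}

/-- The deviation from its mean of the contribution of one antenna to an entry of the normalized Gram
matrix. -/
noncomputable def antennaError (β : ℝ) (j k : Fin K) (c : Fin K → ℂ) : ℂ :=
  c j * star (c k) / (β : ℂ) - (1 : Matrix (Fin K) (Fin K) ℂ) j k

theorem memLp_antennaError (β : ℝ) (j k : Fin K) :
    MemLp (antennaError β j k) 2 (Measure.pi fun _ : Fin K => complexGaussian β) := by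
  have hev : ∀ i : Fin K, MemLp (fun c : Fin K → ℂ => c i) 4
      (Measure.pi fun _ : Fin K => complexGaussian β) := fun i =>
    (memLp_four_complexGaussian β).comp_measurePreserving
      (measurePreserving_eval (fun _ : Fin K => complexGaussian β) i)
  have : ENNReal.HolderTriple 4 4 2 := ⟨by
    rw [← two_mul, show (4 : ENNReal) = 2 * 2 by norm_num,
      ENNReal.mul_inv (by simp) (by simp), ← mul_assoc,
      ENNReal.mul_inv_cancel (by simp) (by simp), one_mul]⟩
  have h := (hev k).star.mul (hev j) (r := 2)
  exact (h.mul_const (β : ℂ)⁻¹).sub (memLp_const _)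

theorem integral_antennaError {β : ℝ} (hβ : 0 < β) (j k : Fin K) :
    ∫ c, antennaError β j k c ∂(Measure.pi fun _ : Fin K => complexGaussian β) = 0 := by
  set ν := Measure.pi fun _ : Fin K => complexGaussian β
  have hint := (memLp_antennaError β j k).integrable one_le_two
  have hint' : Integrable (fun c : Fin K → ℂ => c j * star (c k) / (β : ℂ)) ν := by
    have := hint.add (integrable_const ((1 : Matrix (Fin K) (Fin K) ℂ) j k))
    refine this.congr (.of_forall fun c => ?_)
    simp [antennaError]
  have hβ' : (β : ℂ) ≠ 0 := Complex.ofReal_ne_zero.2 hβ.ne'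
  have heval : ∀ i : Fin K, MeasurePreserving (fun c : Fin K → ℂ => c i) ν (complexGaussian β) :=
    fun i => measurePreserving_eval (fun _ : Fin K => complexGaussian β) i
  simp only [antennaError]
  rw [integral_sub hint' (integrable_const _), integral_const, probReal_univ, one_smul,
    integral_div, sub_eq_zero]
  by_cases hjk : j = k
  · subst hjk
    have h1 : ∫ c : Fin K → ℂ, c j * star (c j) ∂ν = ((∫ z, ‖z‖ ^ 2 ∂complexGaussian β : ℝ) : ℂ) := by
      rw [← integral_comp_measurePreserving (heval j) (by fun_prop), ← integral_complex_ofReal]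
      refine integral_congr_ae (.of_forall fun c => ?_)
      beta_reduce
      rw [Complex.star_def, Complex.mul_conj, Complex.normSq_eq_norm_sq]
    rw [h1, integral_norm_sq_complexGaussian hβ, div_self hβ', Matrix.one_apply_eq]
  · have hind : IndepFun (fun c : Fin K → ℂ => c j) (fun c => c k) ν :=
      (iIndepFun_pi (μ := fun _ : Fin K => complexGaussian β) (X := fun _ z => z)
        fun _ => aemeasurable_id).indepFun hjk
    have hind' : IndepFun (fun c : Fin K → ℂ => c j) (fun c => star (c k)) ν :=
      hind.comp measurable_id (continuous_star (R := ℂ)).measurable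
    have h1 : ∫ c : Fin K → ℂ, c j ∂ν = 0 := by
      rw [← integral_complexGaussian β]
      exact integral_comp_measurePreserving (heval j) aestronglyMeasurable_id
    rw [hind'.integral_fun_mul_eq_mul_integral (measurable_pi_apply j).aestronglyMeasurable
      ((continuous_star (R := ℂ)).measurable.comp (measurable_pi_apply k)).aestronglyMeasurable,
      h1, zero_mul, zero_div, Matrix.one_apply_ne hjk]

theorem normalizedGram_sub_one {M : ℕ} (hM : 0 < M) {β : ℝ} (G : Channel K M)
    (j k : Fin K) : normalizedGram β G j k - (1 : Matrix (Fin K) (Fin K) ℂ) j k =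
      (∑ m, antennaError β j k fun i => G i m) / (M : ℂ) := by
  have hM' : (M : ℂ) ≠ 0 := by exact_mod_cast hM.ne'
  simp only [antennaError, Finset.sum_sub_distrib, ← Finset.sum_div, Finset.sum_const,
    Finset.card_univ, Fintype.card_fin, nsmul_eq_mul, normalizedGram, Matrix.of_apply,
    Complex.ofReal_mul, Complex.ofReal_natCast]
  field_simp

/-- The expected Gram error is of the order of `1 / M`. -/
theorem integrable_gramError (K : ℕ) {β : ℝ} (hβ : 0 < β) :
    ∃ C, 0 ≤ C ∧ ∀ M, 0 < M →
      Integrable (fun G : Channel K M => gramError β G) (channelLaw K M β) ∧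
        ∫ G : Channel K M, gramError β G ∂channelLaw K M β ≤ C / M := by
  set ν := Measure.pi fun _ : Fin K => complexGaussian β
  have hmem := memLp_antennaError (K := K) β
  have hre : ∀ j k : Fin K, MemLp (fun c => (antennaError β j k c).re) 2 ν := fun j k => (hmem j k).re
  have him : ∀ j k : Fin K, MemLp (fun c => (antennaError β j k c).im) 2 ν := fun j k => (hmem j k).im
  have hre0 : ∀ j k : Fin K, ∫ c, (antennaError β j k c).re ∂ν = 0 := fun j k =>
    (integral_re ((hmem j k).integrable one_le_two)).trans (by rw [integral_antennaError hβ]; simp)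
  have him0 : ∀ j k : Fin K, ∫ c, (antennaError β j k c).im ∂ν = 0 := fun j k =>
    (integral_im ((hmem j k).integrable one_le_two)).trans (by rw [integral_antennaError hβ]; simp)
  refine ⟨∑ j : Fin K, ∑ k : Fin K, (∫ c, (antennaError β j k c).re ^ 2 ∂ν +
    ∫ c, (antennaError β j k c).im ^ 2 ∂ν), ?_, fun M hM => ?_⟩
  · refine Finset.sum_nonneg fun j _ => Finset.sum_nonneg fun k _ => add_nonneg ?_ ?_ <;>
      exact integral_nonneg fun c => by positivity
  have hM' : (0 : ℝ) < M := by exact_mod_cast hM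
  have hG : ∀ G : Channel K M, gramError β G = ∑ j, ∑ k,
      ((∑ m, (antennaError β j k fun i => G i m).re) ^ 2 +
        (∑ m, (antennaError β j k fun i => G i m).im) ^ 2) / (M : ℝ) ^ 2 := by
    intro G
    refine Finset.sum_congr rfl fun j _ => Finset.sum_congr rfl fun k _ => ?_
    rw [normalizedGram_sub_one hM, norm_div, div_pow, Complex.norm_natCast,
      ← Complex.normSq_eq_norm_sq, Complex.normSq_apply, Complex.re_sum, Complex.im_sum, ← sq,
      ← sq]
  have hint : ∀ j k : Fin K, Integrable (fun G : Channel K M =>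
      ((∑ m, (antennaError β j k fun i => G i m).re) ^ 2 +
        (∑ m, (antennaError β j k fun i => G i m).im) ^ 2) / (M : ℝ) ^ 2) (channelLaw K M β) :=
    fun j k => ((integral_sq_sum_columns (hre j k) (hre0 j k)).1.add
      (integral_sq_sum_columns (him j k) (him0 j k)).1).div_const _
  simp only [hG]
  refine ⟨integrable_finsetSum _ fun j _ => integrable_finsetSum _ fun k _ => hint j k, ?_⟩
  rw [integral_finsetSum _ fun j _ => integrable_finsetSum _ fun k _ => hint j k, Finset.sum_div]
  refine Finset.sum_le_sum fun j _ => ?_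
  rw [integral_finsetSum _ fun k _ => hint j k, Finset.sum_div]
  refine Finset.sum_le_sum fun k _ => ?_
  rw [integral_div, integral_add (integral_sq_sum_columns (hre j k) (hre0 j k)).1
    (integral_sq_sum_columns (him j k) (him0 j k)).1,
    (integral_sq_sum_columns (hre j k) (hre0 j k)).2,
    (integral_sq_sum_columns (him j k) (him0 j k)).2]
  refine le_of_eq ?_
  field_simp
  rfl

/-- `hardenedRate` grows only logarithmically. -/
theorem tendsto_hardenedRate_div {n : ℕ} {β P : ℝ} (hβ : 0 < β) (hP : 0 < P)
    (σ : ℝ) : Tendsto (fun M : ℕ => (1 + hardenedRate n β P σ M) / M) atTop (𝓝 0) := by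
  set b := P * β / n / σ ^ 2
  have hb : 0 ≤ b := by positivity
  have hlog : Tendsto (fun x : ℝ => Real.log (1 + b * x) / x) atTop (𝓝 0) := by
    have hup : Tendsto (fun x : ℝ => Real.log (1 + b) / x + Real.log x / x) atTop (𝓝 0) := by
      have h := (tendsto_const_nhds (x := Real.log (1 + b))).div_atTop tendsto_id |>.add
        Real.isLittleO_log_id_atTop.tendsto_div_nhds_zero
      rwa [add_zero] at h
    refine squeeze_zero' ?_ ?_ hup
    · filter_upwards [eventually_ge_atTop 1] with x hx
      have := Real.log_nonneg (show 1 ≤ 1 + b * x by nlinarith)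
      positivity
    · filter_upwards [eventually_ge_atTop 1] with x hx
      rw [← add_div, ← Real.log_mul (by positivity) (by positivity)]
      gcongr
      nlinarith
  have h1 : Tendsto (fun M : ℕ => 1 / (M : ℝ)) atTop (𝓝 0) := tendsto_one_div_atTop_nhds_zero_nat
  have h2 := (hlog.comp (tendsto_natCast_atTop_atTop (R := ℝ))).div_const (Real.log 2)
  have h := h1.add h2
  rw [zero_div, add_zero] at h
  refine h.congr fun M => ?_
  have : P * (β * M) / n / σ ^ 2 = b * M := by simp only [b]; ring
  simp only [Function.comp_apply, hardenedRate, Real.logb, this]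
  ring

/-- An expected rate that is close to `hardenedRate` whenever the Gram error is small is
asymptotically equal to it: the Gram error is of the order of `1 / M`, while `hardenedRate` grows
only logarithmically. -/
theorem tendsto_integral_sub_hardenedRate {n : ℕ} {β P : ℝ} (hβ : 0 < β) (hP : 0 < P)
    (σ : ℝ) {f : ∀ M, Channel K M → ℝ}
    (hf : ∀ᶠ M in atTop, Integrable (f M) (channelLaw K M β))
    (h : ∀ η > 0, ∃ C, ∀ M, 0 < M → ∀ G : Channel K M, |f M G - hardenedRate n β P σ M| ≤
      η + C * ((1 + hardenedRate n β P σ M) * gramError β G)) :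
    Tendsto (fun M => ∫ G, f M G ∂channelLaw K M β - hardenedRate n β P σ M) atTop (𝓝 0) := by
  obtain ⟨D, hD0, hD⟩ := integrable_gramError K hβ
  refine Metric.tendsto_nhds.2 fun ε hε => ?_
  obtain ⟨C, hC⟩ := h (ε / 2) (by positivity)
  have hlim := (tendsto_hardenedRate_div (n := n) hβ hP σ).const_mul (|C| * D)
  rw [mul_zero] at hlim
  filter_upwards [hf, eventually_gt_atTop 0, hlim.eventually_lt_const (half_pos hε)]
    with M hfM hM hsmall
  have hc := hardenedRate_nonneg n hβ hP σ M
  have hC := hC M hM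
  obtain ⟨hV, hVint⟩ := hD M hM
  set c := hardenedRate n β P σ M
  have hsub : ∫ G, f M G ∂channelLaw K M β - c = ∫ G, (f M G - c) ∂channelLaw K M β := by
    rw [integral_sub hfM (integrable_const _), integral_const, probReal_univ, one_smul]
  rw [dist_zero_right, hsub]
  calc ‖∫ G, (f M G - c) ∂channelLaw K M β‖
      ≤ ∫ G, ‖f M G - c‖ ∂channelLaw K M β := norm_integral_le_integral_norm _
    _ ≤ ∫ G, (ε / 2 + C * ((1 + c) * gramError β G)) ∂channelLaw K M β :=
        integral_mono (hfM.sub (integrable_const _)).norm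
          ((integrable_const _).add ((hV.const_mul _).const_mul _)) hC
    _ = ε / 2 + C * ((1 + c) * ∫ G, gramError β G ∂channelLaw K M β) := by
        rw [integral_add (integrable_const _) ((hV.const_mul _).const_mul _), integral_const,
          probReal_univ, one_smul, integral_const_mul, integral_const_mul]
    _ ≤ ε / 2 + |C| * ((1 + c) * (D / M)) := by
        have : 0 ≤ ∫ G, gramError β G ∂channelLaw K M β :=
          integral_nonneg fun G => gramError_nonneg β G
        gcongr
        exact le_abs_self C
    _ = ε / 2 + |C| * D * ((1 + c) / M) := by ring
    _ < ε := by linarith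

end Moments

/-! ### Integrability of the rates -/

section Integrability

variable {K M : ℕ}

theorem measurable_zfRate (P σ : ℝ) (S : Finset (Fin K)) :
    Measurable fun G : Channel K M => zfRate P σ (groupRows G S) := by
  have hrows : Continuous fun G : Channel K M => groupRows G S :=
    continuous_matrix fun k m => (continuous_apply m).comp (continuous_apply (k : Fin K))
  have hgram := hrows.matrix_mul hrows.matrix_conjTranspose
  have hentry : ∀ m k, Measurable fun G : Channel K M => zfMatrix (groupRows G S) m k := by
    intro m k
    simp only [zfMatrix, Matrix.mul_apply, Matrix.inv_def, Matrix.smul_apply, smul_eq_mul,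
      Ring.inverse_eq_inv']
    exact Finset.measurable_sum _ fun j _ =>
      (hrows.matrix_conjTranspose.matrix_elem m j).measurable.mul
        (hgram.matrix_det.measurable.inv.mul (hgram.matrix_adjugate.matrix_elem j k).measurable)
  have hpow : Measurable fun G : Channel K M => zfPower (groupRows G S) :=
    Finset.measurable_sum _ fun k _ => Finset.measurable_sum _ fun m _ => (hentry m k).norm.pow_const 2
  unfold zfRate Real.logb
  fun_prop

theorem measurable_channelMagnitude :
    Measurable fun G : Channel K M => channelMagnitude G := by
  unfold channelMagnitude
  fun_prop

theorem measurable_reportedChannel (KM : ℕ) (δ : ℝ) :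
    Measurable fun G : Channel K M => reportedChannel KM δ G := by
  unfold reportedChannel
  fun_prop

theorem integrable_norm_sq_channel (β : ℝ) (k : Fin K) (m : Fin M) :
    Integrable (fun G : Channel K M => ‖G k m‖ ^ 2) (channelLaw K M β) := by
  have h : MemLp (fun z : ℂ => z) 2 (complexGaussian β) :=
    (memLp_four_complexGaussian β).mono_exponent (by norm_num)
  have hev : MeasurePreserving (fun G : Channel K M => G k m) (channelLaw K M β)
      (complexGaussian β) :=
    (measurePreserving_eval (fun _ : Fin M => complexGaussian β) m).comp
      (measurePreserving_eval (fun _ : Fin K => Measure.pi fun _ : Fin M => complexGaussian β) k)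
  exact hev.integrable_comp_of_integrable h.norm.integrable_sq

theorem integrable_zfRate {P : ℝ} (hP : 0 ≤ P) (β σ : ℝ) (S : Finset (Fin K)) :
    Integrable (fun G : Channel K M => zfRate P σ (groupRows G S)) (channelLaw K M β) := by
  have hsum : Integrable (fun G : Channel K M => ∑ k : S, ∑ m, ‖groupRows G S k m‖ ^ 2)
      (channelLaw K M β) :=
    integrable_finsetSum _ fun k _ => integrable_finsetSum _ fun m _ =>
      integrable_norm_sq_channel β (k : Fin K) m
  refine Integrable.mono' (((((hsum.const_mul P).div_const ((Fintype.card S : ℝ) ^ 2)).div_const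
    (σ ^ 2)).div_const (Real.log 2))) (measurable_zfRate P σ S).aestronglyMeasurable
    (.of_forall fun G => ?_)
  rw [Real.norm_eq_abs, abs_of_nonneg (zfRate_nonneg hP σ _)]
  exact (zfRate_le hP σ _).trans (logb_one_add_le (by positivity))

/-- An integrable rate stays integrable if the group is chosen as a function of the channels, because
there are finitely many groups. -/
theorem integrable_of_group {μ : Measure (Channel K M)} {r : Finset (Fin K) → Channel K M → ℝ}
    (hr : ∀ S, Measurable (r S)) (hint : ∀ S, Integrable (r S) μ)
    {s : Channel K M → Finset (Fin K)} (hs : Measurable[_, ⊤] s) :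
    Integrable (fun G => r (s G) G) μ := by
  let _ : MeasurableSpace (Finset (Fin K)) := ⊤
  have hmeas : Measurable fun G => r (s G) G :=
    (measurable_from_prod_countable_right (f := fun p : Finset (Fin K) × Channel K M => r p.1 p.2)
      hr).comp (hs.prodMk measurable_id)
  refine Integrable.mono' (integrable_finsetSum Finset.univ fun S _ => (hint S).norm)
    hmeas.aestronglyMeasurable (.of_forall fun G => ?_)
  exact Finset.single_le_sum (f := fun S => ‖r S G‖) (fun _ _ => norm_nonneg _)
    (Finset.mem_univ (s G))

theorem integrable_accurateMagnitudeRate (KB : ℕ) {P : ℝ} (hP : 0 ≤ P) (β σ : ℝ) (t : ℕ) :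
    Integrable (accurateMagnitudeRate KB P σ t : Channel K M → ℝ) (channelLaw K M β) := by
  have h := integrable_of_group (μ := channelLaw K M β) (measurable_zfRate P σ)
    (integrable_zfRate hP β σ)
    ((measurable_magnitudeGroup KB t).comp (measurable_channelMagnitude (K := K) (M := M)))
  exact h.congr (.of_forall fun G => (groupRate_accurate hP σ G _).symm)

end Integrability

/-! ### Random grouping -/

section RandomGrouping

variable {K M : ℕ}

/-- The users are exchangeable, so all the groups of the same size have the same expected rate. -/
theorem integral_zfRate_eq (P σ β : ℝ) {S S' : Finset (Fin K)} (h : S.card = S'.card) :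
    ∫ G : Channel K M, zfRate P σ (groupRows G S) ∂channelLaw K M β =
      ∫ G : Channel K M, zfRate P σ (groupRows G S') ∂channelLaw K M β := by
  let f : S ≃ S' := Finset.equivOfCardEq h
  let e : Equiv.Perm (Fin K) := Equiv.extendSubtype f
  have he : MeasurePreserving (fun (G : Channel K M) k => G (e k)) (channelLaw K M β)
      (channelLaw K M β) :=
    measurePreserving_comp_equiv (Measure.pi fun _ : Fin M => complexGaussian β) e
  rw [← integral_comp_measurePreserving he (measurable_zfRate P σ S).aestronglyMeasurable]
  refine integral_congr_ae (.of_forall fun G => ?_)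
  exact zfRate_reindex P σ G e f fun k => Equiv.extendSubtype_apply_of_mem f k k.2

theorem integrable_accurateRandomRate (KB : ℕ) {P : ℝ} (hP : 0 ≤ P) (β σ : ℝ) (t : ℕ) :
    Integrable (accurateRandomRate KB P σ t : Channel K M → ℝ) (channelLaw K M β) :=
  (integrable_randomGroupExpect KB (f := fun G : Channel K M => groupRate P σ G G fun _ => True)
    (fun S => by simpa only [groupRate_accurate hP] using integrable_zfRate hP β σ S) t _).1

/-- The expected rate under random grouping is that of any fixed group of `KB` users, in every block. -/
theorem RaRand_eq {KB : ℕ} {P : ℝ} (hP : 0 ≤ P) (β σ : ℝ) {t : ℕ} (ht : (t + 1) * KB ≤ K)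
    {S : Finset (Fin K)} (hS : S.card = KB) : RaRand K KB M β P σ t =
      ∫ G : Channel K M, zfRate P σ (groupRows G S) ∂channelLaw K M β := by
  have h := (integrable_randomGroupExpect KB (μ := channelLaw K M β)
    (f := fun G : Channel K M => groupRate P σ G G fun _ => True)
    (fun S => by simpa only [groupRate_accurate hP] using integrable_zfRate hP β σ S)
    t Finset.univ).2
  refine h.trans (randomGroupExpect_const KB (fun S' hS' => ?_) t _ ?_)
  · simp only [groupRate_accurate hP]
    exact integral_zfRate_eq P σ β (hS'.trans hS.symm)
  · rwa [Finset.card_univ, Fintype.card_fin]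

end RandomGrouping

/-! ### Asymptotic rates -/

section Asymptotics

variable {K : ℕ}

theorem tendsto_RaCM_sub_hardenedRate {KB : ℕ} (hKB : 0 < KB) {β P : ℝ} (hβ : 0 < β) (hP : 0 < P)
    (σ : ℝ) {t : ℕ} (ht : (t + 1) * KB ≤ K) :
    Tendsto (fun M => RaCM K KB M β P σ t - hardenedRate KB β P σ M) atTop (𝓝 0) := by
  refine tendsto_integral_sub_hardenedRate hβ hP σ
    (.of_forall fun M => integrable_accurateMagnitudeRate KB hP.le β σ t) fun η hη => ?_
  obtain ⟨C, -, hC⟩ := exists_forall_abs_zfRate_sub_le K hKB hβ hP σ hη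
  refine ⟨C, fun M hM G => ?_⟩
  rw [accurateMagnitudeRate, groupRate_accurate hP.le]
  exact hC M hM G _ (card_magnitudeGroup KB _ t ht)

theorem tendsto_RaRand_sub_hardenedRate {KB : ℕ} (hKB : 0 < KB) {β P : ℝ} (hβ : 0 < β)
    (hP : 0 < P) (σ : ℝ) {t : ℕ} (ht : (t + 1) * KB ≤ K) :
    Tendsto (fun M => RaRand K KB M β P σ t - hardenedRate KB β P σ M) atTop (𝓝 0) := by
  obtain ⟨S, hS⟩ : ∃ S : Finset (Fin K), S.card = KB :=
    ⟨_, card_magnitudeGroup KB (fun _ => 0) t ht⟩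
  simp only [RaRand_eq hP.le β σ ht hS]
  refine tendsto_integral_sub_hardenedRate hβ hP σ
    (.of_forall fun M => integrable_zfRate hP.le β σ S) fun η hη => ?_
  obtain ⟨C, -, hC⟩ := exists_forall_abs_zfRate_sub_le K hKB hβ hP σ hη
  exact ⟨C, fun M hM G => hC M hM G S hS⟩

/-- A group with fewer than `KB` misreporting users always has an honest one. -/
theorem misreportedMagnitudeRate_eq {KB KM M : ℕ} {P : ℝ} (hP : 0 ≤ P) (δ σ : ℝ) (hKM : KM < KB)
    {t : ℕ} (ht : (t + 1) * KB ≤ K) (G : Channel K M) :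
    misreportedMagnitudeRate KB KM δ P σ t G = zfRate P σ (groupRows (reportedChannel KM δ G)
      (magnitudeGroup KB (channelMagnitude (reportedChannel KM δ G)) t)) := by
  refine groupRate_eq_zfRate hP σ _ G _ _ ?_ fun k hk => reportedChannel_honest δ G hk
  by_contra! h
  have hcard := card_magnitudeGroup KB (channelMagnitude (reportedChannel KM δ G)) t ht
  have := Finset.card_le_card_of_injOn (t := Finset.range KM) (fun j : Fin K => (j : ℕ))
    (fun j hj => by simpa using h j hj) (fun a _ b _ hab => Fin.ext hab)
  rw [hcard, Finset.card_range] at this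
  omega

theorem integrable_misreportedMagnitudeRate {KB KM M : ℕ} {δ P : ℝ} (hP : 0 ≤ P) (hδ : 0 < δ)
    (hδ1 : δ < 1) (β σ : ℝ) (hKM : KM < KB) {t : ℕ} (ht : (t + 1) * KB ≤ K) :
    Integrable (misreportedMagnitudeRate KB KM δ P σ t : Channel K M → ℝ) (channelLaw K M β) := by
  have hmeas : ∀ S : Finset (Fin K), Measurable fun G : Channel K M =>
      zfRate P σ (groupRows (reportedChannel KM δ G) S) := fun S =>
    (measurable_zfRate P σ S).comp (measurable_reportedChannel KM δ)
  have h := integrable_of_group (μ := channelLaw K M β) hmeas (fun S => ?_)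
    ((measurable_magnitudeGroup KB t).comp
      (measurable_channelMagnitude.comp (measurable_reportedChannel KM δ)))
  · exact h.congr (.of_forall fun G => (misreportedMagnitudeRate_eq hP δ σ hKM ht G).symm)
  · refine (integrable_zfRate hP β σ S).mono' (hmeas S).aestronglyMeasurable (.of_forall fun G => ?_)
    rw [Real.norm_eq_abs, abs_of_nonneg (zfRate_nonneg hP σ _)]
    exact (zfRate_reportedChannel hP σ KM hδ hδ1 G S).1

/-- Unless the Gram error is large, the misreporting users have the smallest reported magnitudes. -/
theorem reportedMagnitude_lt {KM M : ℕ} (hM : 0 < M) {δ β : ℝ} (hβ : 0 < β) (hδ : 0 < δ)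
    (hδ1 : δ < 1) {G : Channel K M} (hG : gramError β G < ((1 - δ) / 2) ^ 2) {k j : Fin K}
    (hk : (k : ℕ) < KM) (hj : ¬ (j : ℕ) < KM) :
    channelMagnitude (reportedChannel KM δ G) k < channelMagnitude (reportedChannel KM δ G) j := by
  have hM' : (0 : ℝ) < M := by exact_mod_cast hM
  rw [channelMagnitude_reportedChannel KM hδ.le, channelMagnitude_reportedChannel KM hδ.le,
    if_pos hk, if_neg hj, one_mul, ← div_lt_div_iff_of_pos_right (show 0 < β * M by positivity),
    mul_div_assoc]
  have hk := abs_lt_of_sq_lt_sq ((sq_channelMagnitude_div_sub_le β G k).trans_lt hG) (by linarith)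
  have hj := abs_lt_of_sq_lt_sq ((sq_channelMagnitude_div_sub_le β G j).trans_lt hG) (by linarith)
  rw [abs_lt] at hk hj
  nlinarith

theorem tendsto_RmCM_sub_hardenedRate {KB KM : ℕ} (hKM : KM < KB) {δ β P : ℝ} (hδ : 0 < δ)
    (hδ1 : δ < 1) (hβ : 0 < β) (hP : 0 < P) (σ : ℝ) {t : ℕ} (ht : (t + 2) * KB ≤ K) :
    Tendsto (fun M => RmCM K KB KM M δ β P σ t - hardenedRate KB β P σ M) atTop (𝓝 0) := by
  have ht' : (t + 1) * KB ≤ K := le_trans (Nat.mul_le_mul_right _ (by omega)) ht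
  refine tendsto_integral_sub_hardenedRate hβ hP σ (.of_forall fun M =>
    integrable_misreportedMagnitudeRate hP.le hδ hδ1 β σ hKM ht') fun η hη => ?_
  obtain ⟨C, -, hC⟩ := exists_forall_abs_zfRate_sub_le K (Nat.zero_lt_of_lt hKM) hβ hP σ hη
  -- As `δ (1 + √ε) < 1 - √ε`, a Gram error below `ε` separates the two kinds of users.
  set ε := ((1 - δ) / 2) ^ 2
  have hε : 0 < ε := pow_pos (half_pos (sub_pos.2 hδ1)) 2
  refine ⟨C + |Real.logb 2 δ| / ε, fun M hM G => ?_⟩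
  rw [misreportedMagnitudeRate_eq hP.le δ σ hKM ht' G]
  have hcard := card_magnitudeGroup KB (channelMagnitude (reportedChannel KM δ G)) t ht'
  have hnot := magnitudeGroup_not_lt (channelMagnitude (reportedChannel KM δ G)) t ht hKM
  have hless := fun (hG : gramError β G < ε) (k j : Fin K) =>
    reportedMagnitude_lt (KM := KM) hM hβ hδ hδ1 hG (k := k) (j := j)
  generalize magnitudeGroup KB (channelMagnitude (reportedChannel KM δ G)) t = S at hcard hnot ⊢
  have h1 := hC M hM G S hcard
  have hc := hardenedRate_nonneg KB hβ hP σ M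
  have hV := gramError_nonneg β G
  set c := hardenedRate KB β P σ M
  set V := gramError β G
  have h0 : 0 ≤ |Real.logb 2 δ| / ε * ((1 + c) * V) := by positivity
  rcases lt_or_ge V ε with h | h
  · have hrows : groupRows (reportedChannel KM δ G) S = groupRows G S := by
      ext k m
      exact congrFun (reportedChannel_honest δ G (hnot (hless h) k.2)) m
    rw [hrows, add_mul]
    linarith
  · -- The group may contain misreporting users: the loss is bounded, and the event is rare.
    have h2 := (zfRate_reportedChannel hP.le σ KM hδ hδ1 G S).2
    have h3 : |Real.logb 2 δ| ≤ |Real.logb 2 δ| / ε * ((1 + c) * V) := by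
      have : 1 ≤ V / ε := (one_le_div hε).2 h
      calc |Real.logb 2 δ| ≤ |Real.logb 2 δ| * ((1 + c) * (V / ε)) :=
            le_mul_of_one_le_right (abs_nonneg _) (by nlinarith)
        _ = _ := by ring
    refine (abs_sub_le _ (zfRate P σ (groupRows G S)) _).trans ?_
    rw [add_mul]
    linarith

end Asymptotics

end MassiveMIMO

open MassiveMIMO
theorem proposition2 (T K KB : ℕ) (hKB : 0 < KB) (hK : K = T * KB)
    (β P σ : ℝ) (hβ : 0 < β) (hP : 0 < P) (hσ : 0 < σ) :
    -- the expectations that define the accurate-reporting rates exist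
    (∀ M, KB ≤ M → ∀ t < T,
      Integrable (accurateMagnitudeRate KB P σ t : Channel K M → ℝ) (channelLaw K M β) ∧
      Integrable (accurateRandomRate KB P σ t : Channel K M → ℝ) (channelLaw K M β)) ∧
    -- random and channel magnitude based grouping perform asymptotically the same
    (∀ t < T, Tendsto (fun M => RaCM K KB M β P σ t - RaRand K KB M β P σ t) atTop (𝓝 0)) ∧
    (∀ M, KB ≤ M → ∀ t < T, RaRandPeriod T K KB M β P σ = RaRand K KB M β P σ t) ∧
    -- underreporting by fewer than `KB` users, in the first `T - 1` resource blocks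
    (∀ (KM : ℕ) (δ : ℝ), KM < KB → 0 < δ → δ < 1 →
      (∀ M, KB ≤ M → ∀ t, t + 1 < T →
        Integrable (misreportedMagnitudeRate KB KM δ P σ t : Channel K M → ℝ) (channelLaw K M β)) ∧
      (∀ t, t + 1 < T →
        Tendsto (fun M => RmCM K KB KM M δ β P σ t - RaCM K KB M β P σ t) atTop (𝓝 0))) := by
  have hblock : ∀ s ≤ T, s * KB ≤ K := fun s hs => hK ▸ Nat.mul_le_mul_right KB hs
  refine ⟨fun M _ t _ => ⟨integrable_accurateMagnitudeRate KB hP.le β σ t,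
    integrable_accurateRandomRate KB hP.le β σ t⟩, fun t ht => ?_, fun M _ t ht => ?_,
    fun KM δ hKM hδ hδ1 => ⟨fun M _ t ht => ?_, fun t ht => ?_⟩⟩
  · have h := (tendsto_RaCM_sub_hardenedRate hKB hβ hP σ (hblock (t + 1) ht)).sub
      (tendsto_RaRand_sub_hardenedRate hKB hβ hP σ (hblock (t + 1) ht))
    simpa using h
  · obtain ⟨S, hS⟩ : ∃ S : Finset (Fin K), S.card = KB :=
      ⟨_, card_magnitudeGroup KB (fun _ => 0) t (hblock (t + 1) ht)⟩
    have hT : (T : ℝ) ≠ 0 := by exact_mod_cast (show T ≠ 0 by omega)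
    have hKB' : (KB : ℝ) ≠ 0 := by exact_mod_cast hKB.ne'
    have hK' : (K : ℝ) = T * KB := by rw [hK, Nat.cast_mul]
    rw [RaRandPeriod, Finset.sum_congr rfl fun s hs => by
      rw [RaRand_eq hP.le β σ (hblock (s + 1) (Finset.mem_range.1 hs)) hS],
      RaRand_eq hP.le β σ (hblock (t + 1) ht) hS, Finset.sum_const, Finset.card_range,
      nsmul_eq_mul, hK']
    field_simp
  · exact integrable_misreportedMagnitudeRate hP.le hδ hδ1 β σ hKM (hblock (t + 1) (by omega))
  · have h := (tendsto_RmCM_sub_hardenedRate hKM hδ hδ1 hβ hP σ (hblock (t + 2) ht)).sub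
      (tendsto_RaCM_sub_hardenedRate hKB hβ hP σ (hblock (t + 1) (by omega)))
    simpa using h
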